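/- **Setting.** Let $\mathcal H=L^2(\mathbb R)\otimes\mathbb C^2=L^2(\mathbb R;\mathbb C^2)$, let $m\ge 0$, and let $$H_0=-i\frac{d}{dx}\sigma_1+m\sigma_3,\qquad \sigma_1=\begin{pmatrix}0&1\\1&0\end{pmatrix},\quad \sigma_3=\begin{pmatrix}1&0\\0&-1\end{pmatrix},$$ with domain $H^1(\mathbb R;\mathbb C^2)$, be the free Dirac operator, with resolvent $R_0(z)=(H_0-z)^{-1}$. For a linear operator $T$ in $\mathcal H$, let $\rho(T)$ and $\sigma(T)$ be its resolvent set and its spectrum. Let $V=(V_{ij})_{i,j=1}^2$ be a matrix-valued function (not necessarily Hermitian) with $V_{ij}\in L^1(\mathbb R)$, and let $\|V\|_1=\int_{\mathbb R}\|V(x)\|\,dx$, where $\|V(x)\|$ is the operator norm on $\mathbb C^2$ with the Euclidean norm. **The operator $H=H_0+V$.** Let $V(x)=U(x)|V(x)|$ be the polar decomposition, and let $A=|V|^{1/2}$ and $B=U|V|^{1/2}$ be the maximal multiplication operators in $\mathcal H$, so that $V=BA$. For $z\in\rho(H_0)$ let $Q(z)=\overline{AR_0(z)B}$ be the bounded closure.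 $H$ denotes the closed extension of $H_0+V$ that is defined through its resolvent $$(H-z)^{-1}=R_0(z)-\overline{R_0(z)B}\,(I+Q(z))^{-1}AR_0(z)\qquad\text{for all } z\in\rho(H_0)\text{ with }-1\in\rho(Q(z)).$$ **Notation.** For $z\in\rho(H_0)$ let $k(z)=\sqrt{z^2-m^2}$, with the branch of the square root such that $\operatorname{Im}k(z)>0$, and let $$\Phi(z)=\frac{z+m}{z-m},\qquad \eta(s)=\sqrt{\tfrac12+\tfrac14\left(s+s^{-1}\right)}\quad(s>0).$$ If $\|V\|_1<1$, let $$x_0=\sqrt{\frac{\|V\|_1^4-2\|V\|_1^2+2}{4(1-\|V\|_1^2)}+\frac12},\qquad r_0=\sqrt{\frac{\|V\|_1^4-2\|V\|_1^2+2}{4(1-\|V\|_1^2)}-\frac12}.$$ For $z_0\in\mathbb C$ and $r>0$ let $K_r(z_0)$ be the closed disk with centre $z_0$ and radius $r$, and let $K_0(z_0)=\emptyset$. **Proposition.** Assume that $\|V\|_1<1$. Then $\rho(H_0)=\mathbb C\setminus\big((-\infty,-m]\cup[m,\infty)\big)$, and for every $z\in\rho(H_0)$ outside $K_{mr_0}(mx_0)\cup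 K_{mr_0}(-mx_0)$ we have $z\in\rho(H)$, $\eta(|\Phi(z)|)\,\|V\|_1<1$ and $$\|(H-z)^{-1}\|\le\frac{1}{\operatorname{dist}(z,\sigma(H_0))}+\frac{\eta(|\Phi(z)|)^2}{\operatorname{Im}k(z)}\cdot\frac{\|V\|_1}{1-\eta(|\Phi(z)|)\,\|V\|_1}.$$ -/

import Mathlib

open MeasureTheory Set
open scoped ContDiff

noncomputable section

namespace DiracLine

/-! ### Unbounded operators: resolvent set, spectrum, resolvent -/

section Abstract

variable {H K L : Type*}
  [NormedAddCommGroup H] [InnerProductSpace ℂ H]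
  [NormedAddCommGroup K] [InnerProductSpace ℂ K]
  [NormedAddCommGroup L] [InnerProductSpace ℂ L]

/-- `R` is a bounded, everywhere defined, two-sided inverse of `T - z`. -/
def IsResolventAt (T : H →ₗ.[ℂ] H) (z : ℂ) (R : H →L[ℂ] H) : Prop :=
  (∀ y : H, ∃ h : R y ∈ T.domain, T ⟨R y, h⟩ - z • R y = y) ∧
    ∀ x : T.domain, R (T x - z • (x : H)) = x

/-- The resolvent set `ρ(T)` of an unbounded operator. -/
def resolventSet (T : H →ₗ.[ℂ] H) : Set ℂ := {z | ∃ R : H →L[ℂ] H, IsResolventAt T z R}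

/-- The spectrum `σ(T)` of an unbounded operator. -/
def spectrum (T : H →ₗ.[ℂ] H) : Set ℂ := (resolventSet T)ᶜ

open Classical in
/-- The resolvent `(T - z)⁻¹`, for `z ∈ ρ(T)` (and `0` by convention for other `z`). -/
def resolvent (T : H →ₗ.[ℂ] H) (z : ℂ) : H →L[ℂ] H :=
  if h : z ∈ resolventSet T then Classical.choose h else 0

theorem IsResolventAt.unique {T : H →ₗ.[ℂ] H} {z : ℂ} {R S : H →L[ℂ] H}
    (hR : IsResolventAt T z R) (hS : IsResolventAt T z S) : R = S := by
  ext y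
  obtain ⟨h, hy⟩ := hS.1 y
  have h2 := hR.2 ⟨S y, h⟩
  simp only [hy] at h2
  exact h2

theorem resolvent_spec {T : H →ₗ.[ℂ] H} {z : ℂ} (hz : z ∈ resolventSet T) :
    IsResolventAt T z (resolvent T z) := by
  rw [resolvent, dif_pos hz]
  exact Classical.choose_spec hz

theorem resolvent_eq {T : H →ₗ.[ℂ] H} {z : ℂ} {R : H →L[ℂ] H} (hR : IsResolventAt T z R) :
    resolvent T z = R :=
  (resolvent_spec ⟨R, hR⟩).unique hR

/-- The product `S T` of unbounded operators on its natural domain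
`{x ∈ dom T | T x ∈ dom S}`. -/
def opComp (S : K →ₗ.[ℂ] L) (T : H →ₗ.[ℂ] K) : H →ₗ.[ℂ] L where
  domain := (S.domain.comap T.toFun).map T.domain.subtype
  toFun :=
    { toFun := fun x => S ⟨T ⟨x.1, by
          obtain ⟨y, -, hy⟩ := x.2
          rw [← hy]; exact y.2⟩, by
          obtain ⟨x, y, hy, rfl⟩ := x
          exact hy⟩
      map_add' := fun x y => by
        rw [← LinearPMap.map_add]
        congr 1
        ext
        exact (LinearPMap.map_add T ⟨x.1, _⟩ ⟨y.1, _⟩)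
      map_smul' := fun c x => by
        rw [RingHom.id_apply, ← LinearPMap.map_smul]
        congr 1
        ext
        exact (LinearPMap.map_smul T c ⟨x.1, _⟩) }

/-- A bounded operator as an everywhere defined unbounded one. -/
def ofCLM (R : H →L[ℂ] K) : H →ₗ.[ℂ] K := (R : H →ₗ[ℂ] K).toPMap ⊤

/-- The densely defined operator `T` is bounded, and `S` is its bounded closure: the unique
continuous extension of `T` to the whole space. -/
def IsBoundedClosure (T : H →ₗ.[ℂ] K) (S : H →L[ℂ] K) : Prop :=
  Dense (T.domain : Set H) ∧ ∀ x : T.domain, S x = T x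

theorem IsBoundedClosure.unique {T : H →ₗ.[ℂ] K} {S S' : H →L[ℂ] K}
    (hS : IsBoundedClosure T S) (hS' : IsBoundedClosure T S') : S = S' := by
  have h : (S : H → K) = S' :=
    Continuous.ext_on hS.1 S.continuous S'.continuous fun x hx => by
      rw [hS.2 ⟨x, hx⟩, hS'.2 ⟨x, hx⟩]
  exact DFunLike.coe_injective h

open Classical in
/-- The bounded closure of `T` if there is one, and `0` by convention otherwise. -/
def boundedClosure (T : H →ₗ.[ℂ] K) : H →L[ℂ] K :=
  if h : ∃ S : H →L[ℂ] K, IsBoundedClosure T S then Classical.choose h else 0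

theorem boundedClosure_eq {T : H →ₗ.[ℂ] K} {S : H →L[ℂ] K} (hS : IsBoundedClosure T S) :
    boundedClosure T = S := by
  have h : ∃ S : H →L[ℂ] K, IsBoundedClosure T S := ⟨S, hS⟩
  rw [boundedClosure, dif_pos h]
  exact (Classical.choose_spec h).unique hS

/-! ### The perturbation of `H₀` by a factorized potential `B A` -/

variable (H₀ : H →ₗ.[ℂ] H) (A : H →ₗ.[ℂ] K) (B : K →ₗ.[ℂ] H)

/-- `A R₀(z)`, where `R₀(z) = (H₀ - z)⁻¹`. -/
def opAR (z : ℂ) : H →L[ℂ] K := boundedClosure (opComp A (ofCLM (resolvent H₀ z)))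

/-- The closure of `R₀(z) B`. -/
def opRB (z : ℂ) : K →L[ℂ] H := boundedClosure (opComp (ofCLM (resolvent H₀ z)) B)

/-- The Birman-Schwinger operator `Q(z)`, the closure of `A R₀(z) B`. -/
def opQ (z : ℂ) : K →L[ℂ] K :=
  boundedClosure (opComp A (opComp (ofCLM (resolvent H₀ z)) B))

/-- The set of `z ∈ ρ(H₀)` with `-1 ∈ ρ(Q(z))`. -/
def perturbedResolventSet : Set ℂ :=
  {z | z ∈ resolventSet H₀ ∧ (-1 : ℂ) ∈ _root_.resolventSet ℂ (opQ H₀ A B z)}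

/-- `R(z) = R₀(z) - (closure of R₀(z) B) (I + Q(z))⁻¹ A R₀(z)`. -/
def perturbedResolvent (z : ℂ) : H →L[ℂ] H :=
  resolvent H₀ z - opRB H₀ B z ∘L Ring.inverse (1 + opQ H₀ A B z) ∘L opAR H₀ A z

/-- The graph of the operator `H` with `(H - z)⁻¹ = R(z)` for all `z ∈ ρ(H₀)` with
`-1 ∈ ρ(Q(z))`: as `H f = g` means `(H - z) f = g - z f`, it consists of the pairs `(f, g)`
with `f = R(z) (g - z f)`. -/
def perturbedGraph : Submodule ℂ (H × H) where
  carrier := {p | ∀ z ∈ perturbedResolventSet H₀ A B,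
    p.1 = perturbedResolvent H₀ A B z (p.2 - z • p.1)}
  add_mem' := by
    intro p q hp hq z hz
    have h : p.2 + q.2 - z • (p.1 + q.1) = (p.2 - z • p.1) + (q.2 - z • q.1) := by
      rw [smul_add]; abel
    rw [Prod.fst_add, Prod.snd_add, h, map_add, ← hp z hz, ← hq z hz]
  zero_mem' := by
    intro z _
    simp
  smul_mem' := by
    intro c p hp z hz
    have h : c • p.2 - z • c • p.1 = c • (p.2 - z • p.1) := by
      rw [smul_sub, smul_comm]
    rw [Prod.smul_fst, Prod.smul_snd, h, map_smul, ← hp z hz]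

/-- The closed extension `H` of `H₀ + B A` that is defined through its resolvent `R(z)`. -/
def perturbedOperator : H →ₗ.[ℂ] H := (perturbedGraph H₀ A B).toLinearPMap

end Abstract

/-! ### The free Dirac operator on the line -/

/-- The space `ℂ²` of spinors, with its Euclidean norm. -/
abbrev Spinor : Type := EuclideanSpace ℂ (Fin 2)

/-- The Hilbert space `L²(ℝ) ⊗ ℂ² = L²(ℝ; ℂ²)`. -/
abbrev L2 : Type := Lp Spinor 2 (volume : Measure ℝ)

/-- `g` is the weak derivative of `f`. -/
def IsWeakDeriv (f g : L2) : Prop :=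
  ∀ φ : ℝ → ℝ, ContDiff ℝ ∞ φ → HasCompactSupport φ →
    ∫ x, deriv φ x • f x = -∫ x, φ x • g x

theorem integrable_test_smul (f : L2) {φ : ℝ → ℝ} (hφ : Continuous φ)
    (hc : HasCompactSupport φ) : Integrable (fun x => φ x • f x) := by
  have h := (Lp.memLp f).locallyIntegrable (by norm_num)
  exact h.integrable_smul_left_of_hasCompactSupport hφ hc

theorem IsWeakDeriv.unique {f g g' : L2} (h : IsWeakDeriv f g) (h' : IsWeakDeriv f g') :
    g = g' := by
  refine Lp.ext ?_
  refine ae_eq_of_integral_contDiff_smul_eq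
    ((Lp.memLp g).locallyIntegrable (by norm_num))
    ((Lp.memLp g').locallyIntegrable (by norm_num)) fun φ hφ hc => ?_
  exact neg_injective ((h φ hφ hc).symm.trans (h' φ hφ hc))

theorem IsWeakDeriv.add {f₁ f₂ g₁ g₂ : L2} (h₁ : IsWeakDeriv f₁ g₁) (h₂ : IsWeakDeriv f₂ g₂) :
    IsWeakDeriv (f₁ + f₂) (g₁ + g₂) := by
  intro φ hφ hc
  have hd : Continuous (deriv φ) := hφ.continuous_deriv (by simp)
  have e₁ : (fun x => deriv φ x • (f₁ + f₂ : L2) x) =ᵐ[volume]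
      fun x => deriv φ x • f₁ x + deriv φ x • f₂ x := by
    filter_upwards [Lp.coeFn_add f₁ f₂] with x hx
    rw [hx, Pi.add_apply, smul_add]
  have e₂ : (fun x => φ x • (g₁ + g₂ : L2) x) =ᵐ[volume]
      fun x => φ x • g₁ x + φ x • g₂ x := by
    filter_upwards [Lp.coeFn_add g₁ g₂] with x hx
    rw [hx, Pi.add_apply, smul_add]
  rw [integral_congr_ae e₁, integral_congr_ae e₂,
    integral_add (integrable_test_smul f₁ hd hc.deriv) (integrable_test_smul f₂ hd hc.deriv),
    integral_add (integrable_test_smul g₁ hφ.continuous hc)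
      (integrable_test_smul g₂ hφ.continuous hc), h₁ φ hφ hc, h₂ φ hφ hc, neg_add]

theorem IsWeakDeriv.smul (c : ℂ) {f g : L2} (h : IsWeakDeriv f g) :
    IsWeakDeriv (c • f) (c • g) := by
  intro φ hφ hc
  have e₁ : (fun x => deriv φ x • (c • f : L2) x) =ᵐ[volume] fun x => c • deriv φ x • f x := by
    filter_upwards [Lp.coeFn_smul c f] with x hx
    rw [hx, Pi.smul_apply, smul_comm]
  have e₂ : (fun x => φ x • (c • g : L2) x) =ᵐ[volume] fun x => c • φ x • g x := by
    filter_upwards [Lp.coeFn_smul c g] with x hx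
    rw [hx, Pi.smul_apply, smul_comm]
  rw [integral_congr_ae e₁, integral_congr_ae e₂, integral_smul, integral_smul, h φ hφ hc,
    smul_neg]

theorem IsWeakDeriv.zero : IsWeakDeriv 0 0 := by
  intro φ _ _
  have e : ∀ ψ : ℝ → ℝ, ∫ x, ψ x • (0 : L2) x = 0 := fun ψ => by
    rw [integral_eq_zero_of_ae]
    filter_upwards [Lp.coeFn_zero Spinor 2 (volume : Measure ℝ)] with x hx
    rw [hx, Pi.zero_apply, smul_zero]
  rw [e, e, neg_zero]

/-- The Sobolev space `H¹(ℝ; ℂ²)`. -/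
def H1 : Submodule ℂ L2 where
  carrier := {f | ∃ g : L2, IsWeakDeriv f g}
  add_mem' := fun ⟨_, h₁⟩ ⟨_, h₂⟩ => ⟨_, h₁.add h₂⟩
  zero_mem' := ⟨0, IsWeakDeriv.zero⟩
  smul_mem' := fun c _ ⟨_, h⟩ => ⟨_, h.smul c⟩

/-- The weak derivative on `H¹(ℝ; ℂ²)`. -/
def weakDeriv : H1 →ₗ[ℂ] L2 where
  toFun := fun f => Classical.choose f.2
  map_add' := fun f g => (Classical.choose_spec (f + g).2).unique
    ((Classical.choose_spec f.2).add (Classical.choose_spec g.2))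
  map_smul' := fun c f => (Classical.choose_spec (c • f).2).unique
    ((Classical.choose_spec f.2).smul c)

theorem isWeakDeriv_weakDeriv (f : H1) : IsWeakDeriv f (weakDeriv f) :=
  Classical.choose_spec f.2

/-- A `2 × 2` matrix as an operator on `ℂ²`; its norm is the operator norm for the Euclidean
norm on `ℂ²`. -/
abbrev matOp (M : Matrix (Fin 2) (Fin 2) ℂ) : Spinor →L[ℂ] Spinor :=
  Matrix.toEuclideanCLM (n := Fin 2) (𝕜 := ℂ) M

/-- The Pauli matrix `σ₁`. -/
def pauli1 : Matrix (Fin 2) (Fin 2) ℂ := !![0, 1; 1, 0]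

/-- The Pauli matrix `σ₃`. -/
def pauli3 : Matrix (Fin 2) (Fin 2) ℂ := !![1, 0; 0, -1]

/-- Multiplication by a constant matrix on `L²(ℝ; ℂ²)`. -/
def constMul (M : Matrix (Fin 2) (Fin 2) ℂ) : L2 →L[ℂ] L2 :=
  (matOp M).compLpL 2 (volume : Measure ℝ)

/-- The free Dirac operator `H₀ = -i (d/dx) σ₁ + m σ₃` with domain `H¹(ℝ; ℂ²)`. -/
def freeDirac (m : ℝ) : L2 →ₗ.[ℂ] L2 where
  domain := H1
  toFun := (-Complex.I) • ((constMul pauli1 : L2 →ₗ[ℂ] L2) ∘ₗ weakDeriv) +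
    (m : ℂ) • ((constMul pauli3 : L2 →ₗ[ℂ] L2) ∘ₗ H1.subtype)

/-! ### Multiplication operators and the factorization of the potential -/

theorem memLp_mulFun_congr (W : ℝ → Spinor →L[ℂ] Spinor) {f : L2} {u : ℝ → Spinor}
    (hu : f =ᵐ[volume] u) :
    MemLp (fun x => W x (f x)) 2 volume ↔ MemLp (fun x => W x (u x)) 2 volume :=
  memLp_congr_ae (by filter_upwards [hu] with x hx; rw [hx])

/-- The maximal operator of multiplication by `W`, with domain `{f ∈ L² | W f ∈ L²}`. -/
def mulOp (W : ℝ → Spinor →L[ℂ] Spinor) : L2 →ₗ.[ℂ] L2 where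
  domain :=
    { carrier := {f | MemLp (fun x => W x (f x)) 2 volume}
      add_mem' := fun {f g} hf hg => by
        refine (memLp_mulFun_congr W (Lp.coeFn_add f g)).2 ?_
        simp only [Pi.add_apply, map_add]
        exact MemLp.add (f := fun x => W x (f x)) (g := fun x => W x (g x)) hf hg
      zero_mem' := by
        refine (memLp_mulFun_congr W (Lp.coeFn_zero Spinor 2 volume)).2 ?_
        simp
      smul_mem' := fun c f hf => by
        refine (memLp_mulFun_congr W (Lp.coeFn_smul c f)).2 ?_
        simp only [Pi.smul_apply, map_smul]
        exact MemLp.const_smul (f := fun x => W x (f x)) hf c }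
  toFun :=
    { toFun := fun f => MemLp.toLp (fun x => W x ((f : L2) x)) f.2
      map_add' := fun f g => by
        refine Lp.ext ?_
        filter_upwards [MemLp.coeFn_toLp (f + g).2, MemLp.coeFn_toLp f.2, MemLp.coeFn_toLp g.2,
          Lp.coeFn_add (f : L2) (g : L2), Lp.coeFn_add (MemLp.toLp _ f.2) (MemLp.toLp _ g.2)]
          with x h₁ h₂ h₃ h₄ h₅
        rw [h₁, h₅, Pi.add_apply, h₂, h₃, Submodule.coe_add, h₄, Pi.add_apply, map_add]
      map_smul' := fun c f => by
        refine Lp.ext ?_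
        filter_upwards [MemLp.coeFn_toLp (c • f).2, MemLp.coeFn_toLp f.2,
          Lp.coeFn_smul c (f : L2), Lp.coeFn_smul c (MemLp.toLp _ f.2)] with x h₁ h₂ h₃ h₄
        rw [h₁, RingHom.id_apply, h₄, Pi.smul_apply, h₂, Submodule.coe_smul, h₃, Pi.smul_apply,
          map_smul] }

/-- The square root `|T|^{1/2}` of `|T| = (T* T)^{1/2}`. -/
def sqrtAbs (T : Spinor →L[ℂ] Spinor) : Spinor →L[ℂ] Spinor := CFC.sqrt (CFC.abs T)

/-- The partial isometry `U` in the polar decomposition `T = U |T|`. Since `0⁻¹ = 0`, the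
functional calculus gives the inverse of `|T|` on its range, extended by `0` on its kernel. -/
def polarU (T : Spinor →L[ℂ] Spinor) : Spinor →L[ℂ] Spinor :=
  T * cfc (fun t : ℝ => t⁻¹) (CFC.abs T)

/-- `A = |V|^{1/2}`. -/
def factorA (V : ℝ → Matrix (Fin 2) (Fin 2) ℂ) : L2 →ₗ.[ℂ] L2 :=
  mulOp fun x => sqrtAbs (matOp (V x))

/-- `B = U |V|^{1/2}`, where `V = U |V|` is the polar decomposition. -/
def factorB (V : ℝ → Matrix (Fin 2) (Fin 2) ℂ) : L2 →ₗ.[ℂ] L2 :=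
  mulOp fun x => polarU (matOp (V x)) * sqrtAbs (matOp (V x))

/-- The Dirac operator `H = H₀ + V`, for a potential `V` with entries in `L¹(ℝ)`. -/
def diracOperator (m : ℝ) (V : ℝ → Matrix (Fin 2) (Fin 2) ℂ) : L2 →ₗ.[ℂ] L2 :=
  perturbedOperator (freeDirac m) (factorA V) (factorB V)

/-- `‖V‖₁ = ∫ ‖V(x)‖ dx`, with the operator norm on `ℂ²` in the integrand. -/
def potNorm (V : ℝ → Matrix (Fin 2) (Fin 2) ℂ) : ℝ := ∫ x, ‖matOp (V x)‖

/-! ### The quantities in the estimate -/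

/-- `k(z) = √(z² - m²)`, with the branch of the square root on `ℂ \ [0, ∞)` that has positive
imaginary part: `√w = i √(-w)`, with the principal branch on the right. -/
def kFun (m : ℝ) (z : ℂ) : ℂ := Complex.I * Complex.sqrt (-(z ^ 2 - (m : ℂ) ^ 2))

/-- `Φ(z) = (z + m) / (z - m)`. -/
def phi (m : ℝ) (z : ℂ) : ℂ := (z + m) / (z - m)

/-- `η(s) = √(1/2 + (s + s⁻¹)/4)`. -/
def eta (s : ℝ) : ℝ := Real.sqrt (1 / 2 + 1 / 4 * (s + s⁻¹))

/-- The closed disk `K_r(z₀)`, which is empty by convention for `r = 0`. -/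
def disk (z₀ : ℂ) (r : ℝ) : Set ℂ := if r = 0 then ∅ else Metric.closedBall z₀ r

/-- `x₀`, as a function of `v = ‖V‖₁`. -/
def diskCenter (v : ℝ) : ℝ :=
  Real.sqrt ((v ^ 4 - 2 * v ^ 2 + 2) / (4 * (1 - v ^ 2)) + 1 / 2)

/-- `r₀`, as a function of `v = ‖V‖₁`. -/
def diskRadius (v : ℝ) : ℝ :=
  Real.sqrt ((v ^ 4 - 2 * v ^ 2 + 2) / (4 * (1 - v ^ 2)) - 1 / 2)

end DiracLine

end

/-! For `z` off the half-lines, put `ζ = (z + m) / k(z)`. The Green's function of `H₀` is `(i/2)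
e^{ik|x-y|} (diag(ζ, ζ⁻¹) + sgn(x-y) σ₁)`. Since `|ζ|² = |Φ(z)|`, the Hilbert-Schmidt norm of this
matrix is at most `η(|Φ|) e^{-Im k |x-y|}`, because `(s + s⁻¹ + 2)/4 = η(s)²` (`norm_green_le`).

Both factors of the potential satisfy `‖A(x)‖, ‖B(x)‖ ≤ ‖V(x)‖^{1/2}`. With Cauchy-Schwarz the
kernel bound therefore gives three estimates (`exists_isFactorized`). Bounding the exponential by
`1` yields `‖Q(z)‖ ≤ η ‖V‖₁`. Using `∫ e^{-2 Im k |t|} dt = 1 / Im k` yields `η (‖V‖₁ / Im k)^{1/2}`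
as a bound for both `A R₀(z)` and the closure of `R₀(z) B`. If `η ‖V‖₁ < 1`, then `1 + Q(z)` is
invertible with inverse of norm at most `1 / (1 - η ‖V‖₁)`, and the product of the three bounds is
the second term of the estimate (`IsFactorized.norm_resolvent_le`). The first term bounds `R₀(z)`,
which is normal, so that its norm is its spectral radius (`norm_le_inv_infDist_of_isStarNormal`).

Three further facts are needed. The formula for `(H - z)⁻¹` really is the resolvent of one operator:
the formulas for different `z` satisfy the resolvent identity and are injective
(`IsFactorized.isResolventAt`). The half-lines consist of spectrum of `H₀`, by cut-off plane waves
(`notMem_resolventSet_of_mem_halfLines`). And `η ‖V‖₁ < 1` bounds `|z + m| / |z - m|` from both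
sides, so it fails exactly on two disks of Apollonius (`eta_mul_lt_one` proves the direction
needed). -/

noncomputable section

namespace DiracLine

/-! ### Resolvents and bounded closures of unbounded operators -/

section AbstractLemmas

variable {H K L : Type*}
  [NormedAddCommGroup H] [InnerProductSpace ℂ H]
  [NormedAddCommGroup K] [InnerProductSpace ℂ K]
  [NormedAddCommGroup L] [InnerProductSpace ℂ L]

theorem mem_opComp_domain {S : K →ₗ.[ℂ] L} {T : H →ₗ.[ℂ] K} {x : H} :
    x ∈ (opComp S T).domain ↔ ∃ h : x ∈ T.domain, T ⟨x, h⟩ ∈ S.domain := by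
  constructor
  · rintro ⟨y, hy, rfl⟩
    exact ⟨y.2, hy⟩
  · rintro ⟨h, h'⟩
    exact ⟨⟨x, h⟩, h', rfl⟩

/-- A densely defined operator with a bound extends to a bounded operator with the same bound. -/
theorem exists_isBoundedClosure [CompleteSpace K] {T : H →ₗ.[ℂ] K}
    (hd : Dense (T.domain : Set H)) {C : ℝ} (hC : 0 ≤ C) (hT : ∀ x : T.domain, ‖T x‖ ≤ C * ‖(x : H)‖) :
    ∃ S : H →L[ℂ] K, IsBoundedClosure T S ∧ ‖S‖ ≤ C := by
  let f : T.domain →L[ℂ] K := T.toFun.mkContinuous C hT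
  have hdr : DenseRange (T.domain.subtypeL : T.domain → H) := by
    simpa [DenseRange] using hd
  have hui : IsUniformInducing (T.domain.subtypeL : T.domain → H) :=
    isUniformEmbedding_subtype_val.isUniformInducing
  have hval : ∀ x : T.domain, f.extend T.domain.subtypeL x = T x := fun x =>
    ContinuousLinearMap.extend_eq f hdr hui x
  refine ⟨f.extend T.domain.subtypeL, ⟨hd, hval⟩, ?_⟩
  refine ContinuousLinearMap.opNorm_le_bound _ hC fun x => ?_
  refine hd.induction (P := fun x => ‖f.extend T.domain.subtypeL x‖ ≤ C * ‖x‖) ?_ ?_ x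
  · intro x hx
    rw [hval ⟨x, hx⟩]
    exact hT ⟨x, hx⟩
  · exact isClosed_le (by fun_prop) (by fun_prop)

theorem IsResolventAt.sub_eq {T : H →ₗ.[ℂ] H} {z w : ℂ} {R S : H →L[ℂ] H}
    (hR : IsResolventAt T z R) (hS : IsResolventAt T w S) : R - S = (z - w) • (S ∘L R) := by
  ext y
  obtain ⟨h, hy⟩ := hR.1 y
  have h2 := hS.2 ⟨R y, h⟩
  have h3 : T ⟨R y, h⟩ = y + z • R y := by rw [← sub_eq_iff_eq_add, hy]
  rw [h3] at h2
  have h4 : y + z • R y - w • R y = y + (z - w) • R y := by rw [sub_smul]; abel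
  simp only [h4, map_add, map_smul] at h2
  simp only [sub_apply, smul_apply, ContinuousLinearMap.comp_apply]
  rw [sub_eq_iff_eq_add, add_comm]
  exact h2.symm

theorem IsResolventAt.injective {T : H →ₗ.[ℂ] H} {z : ℂ} {R : H →L[ℂ] H}
    (hR : IsResolventAt T z R) {y : H} (hy : R y = 0) : y = 0 := by
  obtain ⟨h, h'⟩ := hR.1 y
  have e : (⟨R y, h⟩ : T.domain) = 0 := by ext; exact hy
  rw [e, T.map_zero, hy, smul_zero, sub_zero] at h'
  exact h'.symm

theorem resolvent_sub_apply {H₀ : H →ₗ.[ℂ] H} {z w : ℂ} (hz : z ∈ resolventSet H₀)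
    (hw : w ∈ resolventSet H₀) (f : H) :
    resolvent H₀ z f - resolvent H₀ w f = (z - w) • resolvent H₀ w (resolvent H₀ z f) :=
  congrArg (fun T : H →L[ℂ] H => T f) ((resolvent_spec hz).sub_eq (resolvent_spec hw))

theorem inverse_add_apply {Q : H →L[ℂ] H} (hu : IsUnit (1 + Q)) (u : H) :
    Ring.inverse (1 + Q) u + Q (Ring.inverse (1 + Q) u) = u := by
  have := congrArg (fun T : H →L[ℂ] H => T u) (Ring.mul_inverse_cancel _ hu)
  simpa using this

theorem inverse_apply_add {Q : H →L[ℂ] H} (hu : IsUnit (1 + Q)) (u : H) :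
    Ring.inverse (1 + Q) (u + Q u) = u := by
  have := congrArg (fun T : H →L[ℂ] H => T u) (Ring.inverse_mul_cancel _ hu)
  simpa using this

theorem opAR_eq {H₀ : H →ₗ.[ℂ] H} {A : H →ₗ.[ℂ] K} {z : ℂ} {X : H →L[ℂ] K}
    (hX : ∀ f, ∃ h : resolvent H₀ z f ∈ A.domain, A ⟨_, h⟩ = X f) : opAR H₀ A z = X := by
  refine boundedClosure_eq ⟨?_, ?_⟩
  · convert dense_univ
    ext f
    simp only [SetLike.mem_coe, mem_univ, iff_true]
    exact mem_opComp_domain.2 ⟨trivial, (hX f).1⟩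
  · intro x
    rw [← (hX x).2]
    rfl

theorem mem_domain_opComp_ofCLM {R : H →L[ℂ] L} {B : K →ₗ.[ℂ] H} {u : K} :
    u ∈ (opComp (ofCLM R) B).domain ↔ u ∈ B.domain :=
  mem_opComp_domain.trans ⟨fun h => h.1, fun h => ⟨h, trivial⟩⟩

theorem opRB_eq {H₀ : H →ₗ.[ℂ] H} {B : K →ₗ.[ℂ] H} {z : ℂ} {Y : K →L[ℂ] H}
    (hd : Dense (B.domain : Set K)) (hY : ∀ u : B.domain, Y u = resolvent H₀ z (B u)) :
    opRB H₀ B z = Y := by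
  refine boundedClosure_eq ⟨?_, ?_⟩
  · convert hd using 1
    ext u
    exact mem_domain_opComp_ofCLM
  · rintro ⟨u, hu⟩
    exact hY ⟨u, mem_domain_opComp_ofCLM.1 hu⟩

theorem opQ_eq {H₀ : H →ₗ.[ℂ] H} {A : H →ₗ.[ℂ] K} {B : K →ₗ.[ℂ] H} {z : ℂ} {X : H →L[ℂ] K}
    {Q : K →L[ℂ] K} (hd : Dense (B.domain : Set K))
    (hX : ∀ f, ∃ h : resolvent H₀ z f ∈ A.domain, A ⟨_, h⟩ = X f)
    (hQ : ∀ u : B.domain, Q u = X (B u)) :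
    opQ H₀ A B z = Q := by
  refine boundedClosure_eq ⟨?_, ?_⟩
  · convert hd using 1
    ext u
    refine mem_opComp_domain.trans ⟨fun h => mem_domain_opComp_ofCLM.1 h.1, fun h => ?_⟩
    exact ⟨mem_domain_opComp_ofCLM.2 h, (hX _).1⟩
  · rintro ⟨u, hu⟩
    have hu' := mem_domain_opComp_ofCLM.1 (mem_opComp_domain.1 hu).1
    refine (hQ ⟨u, hu'⟩).trans ?_
    rw [← (hX _).2]
    rfl

/-- The hypotheses under which a factorized perturbation `B A` of `H₀` is form-bounded in the
sense of Kato: `X`, `Y`, `Q` are `A R₀(z)` and the bounded closures of `R₀(z) B` and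
`A R₀(z) B`. -/
structure IsFactorized (H₀ : H →ₗ.[ℂ] H) (A : H →ₗ.[ℂ] K) (B : K →ₗ.[ℂ] H)
    (X : ℂ → H →L[ℂ] K) (Y : ℂ → K →L[ℂ] H) (Q : ℂ → K →L[ℂ] K) : Prop where
  dense : Dense (B.domain : Set K)
  closed : ∀ (u : ℕ → A.domain) (f : H) (g : K),
    Filter.Tendsto (fun n => (u n : H)) Filter.atTop (nhds f) →
    Filter.Tendsto (fun n => A (u n)) Filter.atTop (nhds g) → ∃ h : f ∈ A.domain, A ⟨f, h⟩ = g
  AR : ∀ z ∈ resolventSet H₀, ∀ f, ∃ h : resolvent H₀ z f ∈ A.domain, A ⟨_, h⟩ = X z f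
  RB : ∀ z ∈ resolventSet H₀, ∀ u : B.domain, Y z u = resolvent H₀ z (B u)
  ARB : ∀ z ∈ resolventSet H₀, ∀ u : B.domain, Q z u = X z (B u)

/-! ### Kato's construction of the perturbed operator -/

namespace IsFactorized

variable {H₀ : H →ₗ.[ℂ] H} {A : H →ₗ.[ℂ] K} {B : K →ₗ.[ℂ] H}
  {X : ℂ → H →L[ℂ] K} {Y : ℂ → K →L[ℂ] H} {Q : ℂ → K →L[ℂ] K}
  {z w : ℂ}

theorem AR_sub (F : IsFactorized H₀ A B X Y Q) (hz : z ∈ resolventSet H₀) (hw : w ∈ resolventSet H₀) (f : H) :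
    X z f - X w f = (z - w) • X w (resolvent H₀ z f) := by
  obtain ⟨h1, e1⟩ := F.AR z hz f
  obtain ⟨h2, e2⟩ := F.AR w hw f
  obtain ⟨h3, e3⟩ := F.AR w hw (resolvent H₀ z f)
  rw [← e1, ← e2, ← e3, ← A.map_sub, ← A.map_smul]
  congr 1
  ext
  exact resolvent_sub_apply hz hw f

theorem RB_sub (F : IsFactorized H₀ A B X Y Q) (hz : z ∈ resolventSet H₀) (hw : w ∈ resolventSet H₀) (u : K) :
    Y z u - Y w u = (z - w) • resolvent H₀ w (Y z u) := by
  refine F.dense.induction (P := fun u => Y z u - Y w u = (z - w) • resolvent H₀ w (Y z u))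
    ?_ ?_ u
  · intro u hu
    rw [F.RB z hz ⟨u, hu⟩, F.RB w hw ⟨u, hu⟩, resolvent_sub_apply hz hw]
  · exact isClosed_eq (by fun_prop) (by fun_prop)

theorem Q_sub (F : IsFactorized H₀ A B X Y Q) (hz : z ∈ resolventSet H₀) (hw : w ∈ resolventSet H₀) (u : K) :
    Q z u - Q w u = (z - w) • X w (Y z u) := by
  refine F.dense.induction (P := fun u => Q z u - Q w u = (z - w) • X w (Y z u)) ?_ ?_ u
  · intro u hu
    rw [F.RB z hz ⟨u, hu⟩, F.ARB z hz ⟨u, hu⟩, F.ARB w hw ⟨u, hu⟩, F.AR_sub hz hw]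
  · exact isClosed_eq (by fun_prop) (by fun_prop)

/-- On `dom B` this is the hypothesis on `A R₀(z)`; closedness of `A` carries it to limits. It
allows `A` to be applied to `Y z u` for every `u`, which the injectivity of the perturbed resolvent
needs. -/
theorem A_RB (F : IsFactorized H₀ A B X Y Q) (hz : z ∈ resolventSet H₀) (u : K) : ∃ h : Y z u ∈ A.domain, A ⟨_, h⟩ = Q z u := by
  obtain ⟨v, hv, hvu⟩ := mem_closure_iff_seq_limit.1 (F.dense u)
  have hm : ∀ n, ∃ h : Y z (v n) ∈ A.domain, A ⟨_, h⟩ = Q z (v n) := fun n => by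
    rw [F.RB z hz ⟨v n, hv n⟩, F.ARB z hz ⟨v n, hv n⟩]
    exact F.AR z hz _
  refine F.closed (fun n => ⟨Y z (v n), (hm n).1⟩) _ _ (((Y z).continuous.tendsto _).comp hvu) ?_
  simp only [(hm _).2]
  exact ((Q z).continuous.tendsto _).comp hvu

theorem perturbedResolvent_apply (F : IsFactorized H₀ A B X Y Q) (hz : z ∈ resolventSet H₀) (f : H) :
    perturbedResolvent H₀ A B z f =
      resolvent H₀ z f - Y z (Ring.inverse (1 + Q z) (X z f)) := by
  rw [perturbedResolvent, opRB_eq F.dense (F.RB z hz), opAR_eq (F.AR z hz),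
    opQ_eq F.dense (F.AR z hz) (F.ARB z hz)]
  rfl

theorem mem_perturbedResolventSet (F : IsFactorized H₀ A B X Y Q) :
    z ∈ perturbedResolventSet H₀ A B ↔ z ∈ resolventSet H₀ ∧ IsUnit (1 + Q z) := by
  refine and_congr_right fun hz => ?_
  rw [opQ_eq F.dense (F.AR z hz) (F.ARB z hz), spectrum.mem_resolventSet_iff,
    ← IsUnit.neg_iff]
  congr! 1
  simp [add_comm]

/-- The resolvent identity for the perturbed resolvents. -/
theorem perturbedResolvent_sub (F : IsFactorized H₀ A B X Y Q) (hz : z ∈ perturbedResolventSet H₀ A B)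
    (hw : w ∈ perturbedResolventSet H₀ A B) (f : H) :
    perturbedResolvent H₀ A B z f - perturbedResolvent H₀ A B w f =
      (z - w) • perturbedResolvent H₀ A B w (perturbedResolvent H₀ A B z f) := by
  obtain ⟨hz, hqz⟩ := F.mem_perturbedResolventSet.1 hz
  obtain ⟨hw, hqw⟩ := F.mem_perturbedResolventSet.1 hw
  simp only [F.perturbedResolvent_apply hz, F.perturbedResolvent_apply hw]
  set v := Ring.inverse (1 + Q z) (X z f) with hv
  have e1 := resolvent_sub_apply hz hw f
  have e2 := F.RB_sub hz hw v
  have e3 := F.AR_sub hz hw f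
  have e4 := F.Q_sub hz hw v
  have e5 : v + Q z v = X z f := inverse_add_apply hqz _
  -- The argument of the inverse equals `(v + Q w v) - X w f`: replace `X z f` by `v + Q z v` in
  -- `e3` and subtract `e4`.
  have e6 : Ring.inverse (1 + Q w) ((z - w) • (X w (resolvent H₀ z f) - X w (Y z v))) =
      v - Ring.inverse (1 + Q w) (X w f) := by
    rw [smul_sub, ← e3, ← e4, ← e5, ← inverse_apply_add hqw v, ← map_sub, inverse_apply_add hqw v]
    congr 1
    abel
  rw [map_sub, smul_sub, smul_sub, ← e1, ← e2, map_sub, ← map_smul (Y w), ← map_smul, e6, map_sub]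
  abel

/-- If `R₀ f = Y v` with `v = (1 + Q)⁻¹ X f`, applying `A` gives `X f = Q v`. But `X f = v + Q v`,
so `v = 0`, hence `R₀ f = 0` and `f = 0`. -/
theorem perturbedResolvent_injective (F : IsFactorized H₀ A B X Y Q) (hz : z ∈ perturbedResolventSet H₀ A B) {f : H}
    (hf : perturbedResolvent H₀ A B z f = 0) : f = 0 := by
  obtain ⟨hz, hqz⟩ := F.mem_perturbedResolventSet.1 hz
  rw [F.perturbedResolvent_apply hz] at hf
  set v := Ring.inverse (1 + Q z) (X z f) with hv
  obtain ⟨h1, e1⟩ := F.AR z hz f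
  obtain ⟨h2, e2⟩ := F.A_RB hz v
  have e3 : (⟨_, h1⟩ : A.domain) = ⟨_, h2⟩ := by
    ext; exact sub_eq_zero.1 hf
  have e4 : X z f = Q z v := by rw [← e1, e3, e2]
  have e5 : v = 0 := by
    have := inverse_add_apply hqz (X z f)
    rw [← hv, ← e4] at this
    simpa using this
  rw [e5, map_zero, sub_zero] at hf
  exact (resolvent_spec hz).injective hf

/-- Injectivity at one point `z` makes `perturbedGraph` the graph of an operator, without which
`toLinearPMap` would carry no information. Membership in the graph is a condition at all points at
once; the resolvent identity derives it from the condition at `z` alone. -/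
theorem isResolventAt (F : IsFactorized H₀ A B X Y Q) (hz : z ∈ perturbedResolventSet H₀ A B) :
    IsResolventAt (perturbedOperator H₀ A B) z (perturbedResolvent H₀ A B z) := by
  have hg : ∀ p ∈ perturbedGraph H₀ A B, p.1 = 0 → p.2 = 0 := fun p hp h0 => by
    have := hp z hz
    rw [h0, smul_zero, sub_zero] at this
    exact F.perturbedResolvent_injective hz this.symm
  have hgraph : (perturbedOperator H₀ A B).graph = perturbedGraph H₀ A B :=
    Submodule.toLinearPMap_graph_eq _ hg
  refine ⟨fun y => ?_, fun x => ?_⟩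
  · have hm : (perturbedResolvent H₀ A B z y, y + z • perturbedResolvent H₀ A B z y) ∈
        (perturbedOperator H₀ A B).graph := by
      rw [hgraph]
      intro w hw
      have := F.perturbedResolvent_sub hz hw y
      rw [add_sub_assoc, ← sub_smul, map_add, map_smul, ← this]
      abel
    obtain ⟨x, hx1, hx2⟩ := (LinearPMap.mem_graph_iff _).1 hm
    simp only at hx1 hx2
    have hd : perturbedResolvent H₀ A B z y ∈ (perturbedOperator H₀ A B).domain := hx1 ▸ x.2
    refine ⟨hd, ?_⟩
    have : (⟨_, hd⟩ : (perturbedOperator H₀ A B).domain) = x := by ext; exact hx1.symm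
    rw [this, hx2]
    abel
  · have hm := (perturbedOperator H₀ A B).mem_graph x
    rw [hgraph] at hm
    exact (hm z hz).symm

theorem norm_resolvent_le (F : IsFactorized H₀ A B X Y Q) [CompleteSpace K] {CX CY q : ℝ} (hz : z ∈ resolventSet H₀)
    (hX : ‖X z‖ ≤ CX) (hY : ‖Y z‖ ≤ CY) (hQ : ‖Q z‖ ≤ q) (hq : q < 1) :
    z ∈ resolventSet (perturbedOperator H₀ A B) ∧
      ‖resolvent (perturbedOperator H₀ A B) z‖ ≤ ‖resolvent H₀ z‖ + CY * (CX / (1 - q)) := by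
  have hu : IsUnit (1 + Q z) := by
    have := (Units.oneSub (-Q z) (by rw [norm_neg]; exact hQ.trans_lt hq)).isUnit
    simpa using this
  have hzp := F.mem_perturbedResolventSet.2 ⟨hz, hu⟩
  have hR := F.isResolventAt hzp
  refine ⟨⟨_, hR⟩, ?_⟩
  rw [resolvent_eq hR]
  have hCX : 0 ≤ CX := (norm_nonneg _).trans hX
  have hCY : 0 ≤ CY := (norm_nonneg _).trans hY
  have hq1 : 0 < 1 - q := sub_pos.2 hq
  refine ContinuousLinearMap.opNorm_le_bound _ (by positivity) fun f => ?_
  rw [F.perturbedResolvent_apply hz, add_mul]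
  refine (norm_sub_le _ _).trans (add_le_add (ContinuousLinearMap.le_opNorm _ _) ?_)
  set v := Ring.inverse (1 + Q z) (X z f) with hv
  have e5 : v + Q z v = X z f := inverse_add_apply hu _
  have h1 : ‖X z f‖ ≤ CX * ‖f‖ := (X z).le_of_opNorm_le hX f
  have h2 : ‖Q z v‖ ≤ q * ‖v‖ := (Q z).le_of_opNorm_le hQ v
  -- The bound on the inverse is read off from `v + Q z v = X z f`, without summing the Neumann
  -- series.
  have h3 : ‖v‖ ≤ ‖X z f‖ + ‖Q z v‖ := by
    rw [← eq_sub_iff_add_eq] at e5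
    calc ‖v‖ = ‖X z f - Q z v‖ := by rw [← e5]
      _ ≤ _ := norm_sub_le _ _
  have h4 : ‖v‖ ≤ CX / (1 - q) * ‖f‖ := by
    rw [div_mul_eq_mul_div, le_div_iff₀ hq1]
    nlinarith
  calc ‖Y z v‖ ≤ CY * ‖v‖ := (Y z).le_of_opNorm_le hY v
    _ ≤ CY * (CX / (1 - q) * ‖f‖) := by gcongr
    _ = _ := by ring

end IsFactorized

/-- A nonzero `l` in the spectrum of `R = (T - z)⁻¹` comes from the point `z + l⁻¹` of `σ(T)`, so
`|l|` is at most the inverse distance; for normal `R` the spectral radius is the norm. The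
hypothesis `hd` also rules out an empty spectrum, for which `infDist` is `0` by convention. -/
theorem norm_le_inv_infDist_of_isStarNormal [CompleteSpace H] {T : H →ₗ.[ℂ] H} {z : ℂ}
    {R : H →L[ℂ] H} (hR : IsResolventAt T z R) [IsStarNormal R]
    (hd : 0 < Metric.infDist z (spectrum T)) : ‖R‖ ≤ 1 / Metric.infDist z (spectrum T) := by
  have key : ∀ l ∈ _root_.spectrum ℂ R, ‖l‖ ≤ 1 / Metric.infDist z (spectrum T) := by
    intro l hl
    by_cases h0 : l = 0
    · rw [h0, norm_zero]; positivity
    have hmem : z + l⁻¹ ∈ spectrum T := by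
      rintro ⟨S, hS⟩
      refine hl ?_
      have h1 := hS.sub_eq hR
      have h2 := hR.sub_eq hS
      rw [add_sub_cancel_left] at h1
      have h2' : S - R = l⁻¹ • (S ∘L R) := by
        rw [← neg_sub, h2, ← neg_smul]; congr 1; ring
      rw [_root_.spectrum.mem_resolventSet_iff]
      have e1 : ∀ f, S f - R f = l⁻¹ • R (S f) := fun f =>
        congrArg (fun T : H →L[ℂ] H => T f) h1
      have e2 : ∀ f, S f - R f = l⁻¹ • S (R f) := fun f =>
        congrArg (fun T : H →L[ℂ] H => T f) h2'
      -- With `S = (T - z - l⁻¹)⁻¹`, the inverse of `l - R` is `l⁻¹ (1 + l⁻¹ S)`.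
      refine isUnit_iff_exists.2 ⟨l⁻¹ • (1 + l⁻¹ • S), ?_, ?_⟩
      · ext f
        have : l⁻¹ • (l • f + S f - R f - l⁻¹ • R (S f)) = f := by
          rw [← e1, add_sub_assoc, add_sub_cancel_right, inv_smul_smul₀ h0]
        rw [← sub_eq_zero] at this ⊢
        rw [← this]
        simp
        match_scalars <;> field_simp
      · ext f
        have : l⁻¹ • (l • f + S f - R f - l⁻¹ • S (R f)) = f := by
          rw [← e2, add_sub_assoc, add_sub_cancel_right, inv_smul_smul₀ h0]
        rw [← sub_eq_zero] at this ⊢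
        rw [← this]
        simp
        match_scalars <;> field_simp
    have := Metric.infDist_le_dist_of_mem (x := z) hmem
    rw [dist_self_add_right, norm_inv] at this
    rw [le_div_iff₀ hd]
    have hl0 : 0 < ‖l‖ := norm_pos_iff.2 h0
    calc ‖l‖ * _ ≤ ‖l‖ * ‖l‖⁻¹ := by gcongr
      _ = 1 := mul_inv_cancel₀ hl0.ne'
  have h := IsStarNormal.spectralRadius_eq_nnnorm R
  have h' : spectralRadius ℂ R ≤ ENNReal.ofReal (1 / Metric.infDist z (spectrum T)) := by
    refine iSup₂_le fun l hl => ?_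
    rw [← enorm_eq_nnnorm, ← ofReal_norm]
    exact ENNReal.ofReal_le_ofReal (key l hl)
  rwa [h, ← enorm_eq_nnnorm, ← ofReal_norm, ENNReal.ofReal_le_ofReal_iff (by positivity)] at h'

end AbstractLemmas

/-! ### Norms and measurability of the factors of the potential -/

section PolarDecomposition

open Filter Topology

section CStar

variable {𝔸 : Type*} [CStarAlgebra 𝔸] [PartialOrder 𝔸] [StarOrderedRing 𝔸]

/-- Since `a* a = |a|²`, the elements `a g(|a|)` and `|a| g(|a|)` have the same `x* x`, hence the
same norm. The second is a function of `|a|`, so a bound on its symbol `t g(t)` suffices. -/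
theorem norm_mul_cfc_abs_le (a : 𝔸) (g : ℝ → ℝ)
    (hgc : ContinuousOn g (_root_.spectrum ℝ (CFC.abs a))) {c : ℝ} (hc : 0 ≤ c)
    (hg : ∀ t ∈ _root_.spectrum ℝ (CFC.abs a), ‖t * g t‖ ≤ c) :
    ‖a * cfc g (CFC.abs a)‖ ≤ c := by
  have hP : IsSelfAdjoint (CFC.abs a) := (CFC.abs_nonneg a).isSelfAdjoint
  have e : cfc (fun t => t * g t) (CFC.abs a) = CFC.abs a * cfc g (CFC.abs a) := by
    rw [cfc_mul (fun t => t) g _ (by fun_prop) hgc, cfc_id' ℝ _ hP]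
  have h1 : star (a * cfc g (CFC.abs a)) * (a * cfc g (CFC.abs a)) =
      star (cfc (fun t => t * g t) (CFC.abs a)) * cfc (fun t => t * g t) (CFC.abs a) := by
    rw [e, star_mul, star_mul, hP.star_eq, mul_assoc, mul_assoc, ← mul_assoc (star a),
      ← mul_assoc (CFC.abs a), CFC.abs_mul_abs]
  have h2 : ‖a * cfc g (CFC.abs a)‖ = ‖cfc (fun t => t * g t) (CFC.abs a)‖ := by
    rw [← mul_self_inj_of_nonneg (norm_nonneg _) (norm_nonneg _), ← CStarRing.norm_star_mul_self,
      h1]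
    exact CStarRing.norm_star_mul_self
  rw [h2]
  exact norm_cfc_le hc hg

theorem continuous_mul_cfc_abs {g : ℝ → ℝ} (hg : Continuous g) :
    Continuous fun a : 𝔸 => a * cfc g (CFC.abs a) := by
  refine continuous_id.mul ?_
  exact Continuous.cfc_of_mem_nhdsSet (s := univ) g Filter.univ_mem CFC.continuous_abs
    (fun T => (CFC.abs_nonneg T).isSelfAdjoint) hg.continuousOn

theorem sqrt_abs_eq_cfc (a : 𝔸) : CFC.sqrt (CFC.abs a) = cfc Real.sqrt (CFC.abs a) := by
  rw [CFC.sqrt_eq_real_sqrt _ (CFC.abs_nonneg a), cfcₙ_eq_cfc]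

theorem mul_cfc_inv_mul_sqrt_abs (a : 𝔸)
    (hc : ContinuousOn (fun t : ℝ => t⁻¹) (_root_.spectrum ℝ (CFC.abs a))) :
    a * cfc (fun t : ℝ => t⁻¹) (CFC.abs a) * CFC.sqrt (CFC.abs a) =
      a * cfc (fun t : ℝ => t⁻¹ * √t) (CFC.abs a) := by
  rw [sqrt_abs_eq_cfc, mul_assoc, cfc_mul _ _ _ hc Real.continuous_sqrt.continuousOn]

theorem norm_mul_cfc_inv_mul_sqrt_abs_le (a : 𝔸)
    (hc : ContinuousOn (fun t : ℝ => t⁻¹) (_root_.spectrum ℝ (CFC.abs a))) :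
    ‖a * cfc (fun t : ℝ => t⁻¹) (CFC.abs a) * CFC.sqrt (CFC.abs a)‖ ≤ √‖a‖ := by
  rw [mul_cfc_inv_mul_sqrt_abs a hc]
  refine norm_mul_cfc_abs_le a (fun t : ℝ => t⁻¹ * √t) (hc.mul Real.continuous_sqrt.continuousOn)
    (Real.sqrt_nonneg _) fun t ht => ?_
  rcases subsingleton_or_nontrivial 𝔸 with h𝔸 | h𝔸
  · simp [_root_.spectrum.of_subsingleton] at ht
  have h1 : ‖t‖ ≤ ‖a‖ := by
    rw [← CFC.norm_abs (a := a)]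
    exact _root_.spectrum.norm_le_norm_of_mem ht
  by_cases h : t = 0
  · simp [h]
  · rw [mul_inv_cancel_left₀ h, Real.norm_of_nonneg (Real.sqrt_nonneg _)]
    exact Real.sqrt_le_sqrt ((le_abs_self t).trans h1)

/-- The polar factor is not continuous in `a`, so measurability of `U |V|^{1/2}` is obtained from a
limit. The symbol `t⁻¹ √t` is regularized to `√t / (|t| + ε)`, which is continuous on all of `ℝ`. -/
theorem tendsto_mul_cfc_sqrt_div (a : 𝔸)
    (hc : ContinuousOn (fun t : ℝ => t⁻¹) (_root_.spectrum ℝ (CFC.abs a))) :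
    Tendsto (fun n : ℕ => a * cfc (fun t : ℝ => √t / (|t| + 1 / ((n : ℝ) + 1))) (CFC.abs a)) atTop
      (𝓝 (a * cfc (fun t : ℝ => t⁻¹) (CFC.abs a) * CFC.sqrt (CFC.abs a))) := by
  rw [mul_cfc_inv_mul_sqrt_abs a hc, tendsto_iff_norm_sub_tendsto_zero]
  have h0 : Tendsto (fun n : ℕ => √(1 / ((n : ℝ) + 1))) atTop (𝓝 0) := by
    have := (Real.continuous_sqrt.tendsto 0).comp tendsto_one_div_add_atTop_nhds_zero_nat
    simpa [Function.comp_def] using this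
  refine squeeze_zero (fun _ => norm_nonneg _) (fun n => ?_) h0
  have c1 : ContinuousOn (fun t : ℝ => t⁻¹ * √t) (_root_.spectrum ℝ (CFC.abs a)) :=
    hc.mul Real.continuous_sqrt.continuousOn
  have c2 : ContinuousOn (fun t : ℝ => √t / (|t| + 1 / ((n : ℝ) + 1)))
      (_root_.spectrum ℝ (CFC.abs a)) :=
    (Real.continuous_sqrt.div₀ (by fun_prop) fun t => by positivity).continuousOn
  rw [← mul_sub, ← cfc_sub _ _ _ c2 c1]
  refine norm_mul_cfc_abs_le a _ (c2.sub c1) (Real.sqrt_nonneg _) fun t ht => ?_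
  have ht0 : 0 ≤ t := spectrum_nonneg_of_nonneg (CFC.abs_nonneg a) ht
  set ε : ℝ := 1 / ((n : ℝ) + 1) with hε
  have hε0 : 0 < ε := by positivity
  rcases ht0.eq_or_lt with rfl | hpos
  · simp
  have e : t * (√t / (|t| + ε) - t⁻¹ * √t) = -(√t * ε / (t + ε)) := by
    rw [abs_of_nonneg ht0]; field_simp; ring
  rw [Pi.sub_apply, e, norm_neg, Real.norm_of_nonneg (by positivity), div_le_iff₀ (by positivity)]
  have h1 := Real.sq_sqrt ht0
  have h2 := Real.sq_sqrt hε0.le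
  have h3 : 0 ≤ √t * √ε := by positivity
  have h4 : 0 ≤ √ε := Real.sqrt_nonneg _
  -- The error symbol `√t ε / (t + ε)` is at most `√ε`, uniformly in `t`, because `√(t ε) ≤ t + ε`.
  calc √t * ε = √ε * (√t * √ε) := by linear_combination (-√t) * h2
    _ ≤ √ε * (t + ε) := by
      gcongr
      nlinarith [sq_nonneg (√t - √ε)]

end CStar

theorem norm_sqrtAbs (T : Spinor →L[ℂ] Spinor) : ‖sqrtAbs T‖ = √‖T‖ := by
  rw [sqrtAbs, CFC.norm_sqrt _ (CFC.abs_nonneg T), CFC.norm_abs]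

theorem continuous_sqrtAbs : Continuous sqrtAbs :=
  CFC.continuousOn_sqrt.comp_continuous CFC.continuous_abs CFC.abs_nonneg

theorem finite_real_spectrum (T : Spinor →L[ℂ] Spinor) : (_root_.spectrum ℝ T).Finite := by
  rw [← _root_.spectrum.preimage_algebraMap ℂ]
  refine Set.Finite.preimage (FaithfulSMul.algebraMap_injective ℝ ℂ).injOn ?_
  rw [← AlgEquiv.spectrum_eq (Matrix.toEuclideanCLM (n := Fin 2) (𝕜 := ℂ)).symm T]
  exact Matrix.finite_spectrum _

/-- Every function is continuous on the finite spectrum of an operator on `ℂ²`. -/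
theorem continuousOn_spectrum (g : ℝ → ℝ) (T : Spinor →L[ℂ] Spinor) :
    ContinuousOn g (_root_.spectrum ℝ T) := (finite_real_spectrum T).continuousOn g

theorem norm_polarU_mul_sqrtAbs_le (T : Spinor →L[ℂ] Spinor) :
    ‖polarU T * sqrtAbs T‖ ≤ √‖T‖ :=
  norm_mul_cfc_inv_mul_sqrt_abs_le T (continuousOn_spectrum _ _)

theorem tendsto_polarU_mul_sqrtAbs (T : Spinor →L[ℂ] Spinor) :
    Tendsto (fun n : ℕ => T * cfc (fun t : ℝ => √t / (|t| + 1 / ((n : ℝ) + 1))) (CFC.abs T)) atTop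
      (𝓝 (polarU T * sqrtAbs T)) :=
  tendsto_mul_cfc_sqrt_div T (continuousOn_spectrum _ _)

theorem stronglyMeasurable_polarU_mul_sqrtAbs :
    StronglyMeasurable fun T : Spinor →L[ℂ] Spinor => polarU T * sqrtAbs T := by
  have hg : ∀ n : ℕ, Continuous fun t : ℝ => √t / (|t| + 1 / ((n : ℝ) + 1)) := fun n =>
    Real.continuous_sqrt.div₀ (by fun_prop) fun t => by positivity
  exact stronglyMeasurable_of_tendsto atTop
    (fun n => (continuous_mul_cfc_abs (hg n)).stronglyMeasurable)
    (tendsto_pi_nhds.2 tendsto_polarU_mul_sqrtAbs)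

theorem matOp_eq_sum (M : Matrix (Fin 2) (Fin 2) ℂ) :
    matOp M = ∑ p : Fin 2 × Fin 2, M p.1 p.2 • matOp (Matrix.single p.1 p.2 1) := by
  conv_lhs => rw [Matrix.matrix_eq_sum_single M]
  rw [← Finset.univ_product_univ, Finset.sum_product]
  simp only [map_sum]
  congr! with i _ j _
  rw [← map_smul, Matrix.smul_single, smul_eq_mul, mul_one]

theorem integrable_sum_smul {α ι E : Type*} [MeasurableSpace α] {μ : Measure α} [Fintype ι]
    [NormedAddCommGroup E] [NormedSpace ℂ E] {c : ι → α → ℂ} (hc : ∀ i, Integrable (c i) μ)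
    (v : ι → E) : Integrable (fun x => ∑ i, c i x • v i) μ :=
  integrable_finsetSum _ fun i _ => (hc i).smul_const _

variable {V : ℝ → Matrix (Fin 2) (Fin 2) ℂ}

theorem integrable_matOp (hV : ∀ i j : Fin 2, Integrable (fun x : ℝ => V x i j) volume) :
    Integrable (fun x => matOp (V x)) := by
  have h := integrable_sum_smul (c := fun (p : Fin 2 × Fin 2) x => V x p.1 p.2)
    (fun p => hV p.1 p.2) (fun p => matOp (Matrix.single p.1 p.2 1))
  exact h.congr (ae_of_all _ fun x => (matOp_eq_sum (V x)).symm)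

theorem potNorm_nonneg (V : ℝ → Matrix (Fin 2) (Fin 2) ℂ) : 0 ≤ potNorm V :=
  integral_nonneg fun _ => norm_nonneg _

end PolarDecomposition

/-! ### Maximal multiplication operators: closedness and density of the domain -/

section MulOp

open Filter Topology

variable {W : ℝ → Spinor →L[ℂ] Spinor}

theorem coeFn_mulOp (f : (mulOp W).domain) :
    (mulOp W f : L2) =ᵐ[volume] fun x => W x ((f : L2) x) := MemLp.coeFn_toLp f.2

theorem mulOp_eq_iff {f : L2} {g : L2} :
    (∃ h : f ∈ (mulOp W).domain, mulOp W ⟨f, h⟩ = g) ↔ ∀ᵐ x, W x (f x) = g x := by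
  constructor
  · rintro ⟨h, rfl⟩
    filter_upwards [coeFn_mulOp ⟨f, h⟩] with x hx using hx.symm
  · intro h
    have hm : f ∈ (mulOp W).domain := (memLp_congr_ae h).2 (Lp.memLp g)
    refine ⟨hm, Lp.ext ?_⟩
    filter_upwards [coeFn_mulOp ⟨f, hm⟩, h] with x hx hx'
    rw [hx, ← hx']

theorem exists_subseq_ae_tendsto {u : ℕ → L2} {f : L2} (h : Tendsto u atTop (𝓝 f)) :
    ∃ ns : ℕ → ℕ, StrictMono ns ∧ ∀ᵐ x, Tendsto (fun n => u (ns n) x) atTop (𝓝 (f x)) :=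
  (tendstoInMeasure_of_tendsto_Lp h).exists_seq_tendsto_ae

theorem mulOp_closed (u : ℕ → (mulOp W).domain) (f g : L2)
    (hf : Tendsto (fun n => (u n : L2)) atTop (𝓝 f))
    (hg : Tendsto (fun n => mulOp W (u n)) atTop (𝓝 g)) :
    ∃ h : f ∈ (mulOp W).domain, mulOp W ⟨f, h⟩ = g := by
  obtain ⟨ns, hns, h1⟩ := exists_subseq_ae_tendsto hf
  obtain ⟨ms, hms, h2⟩ := exists_subseq_ae_tendsto (hg.comp hns.tendsto_atTop)
  rw [mulOp_eq_iff]
  filter_upwards [h1, h2, ae_all_iff.2 fun n => coeFn_mulOp (u n)] with x h1 h2 h3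
  have h4 := ((W x).continuous.tendsto _).comp (h1.comp hms.tendsto_atTop)
  refine tendsto_nhds_unique h4 ?_
  simpa only [Function.comp_def, h3] using h2

theorem aestronglyMeasurable_apply (hW : AEStronglyMeasurable W) {f : ℝ → Spinor}
    (hf : AEStronglyMeasurable f) : AEStronglyMeasurable fun x => W x (f x) :=
  (ContinuousLinearMap.id ℂ (Spinor →L[ℂ] Spinor)).aestronglyMeasurable_comp₂ hW hf

/-- If `g` is orthogonal to the domain, test it with `g / (1 + ‖W‖)`, which lies in the domain. Then
`∫ |g|² / (1 + ‖W‖) = 0` and `g = 0`. -/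
theorem dense_mulOp_domain (hW : AEStronglyMeasurable W) :
    Dense ((mulOp W).domain : Set L2) := by
  rw [Submodule.dense_iff_topologicalClosure_eq_top, Submodule.topologicalClosure_eq_top_iff,
    Submodule.eq_bot_iff]
  intro g hg
  have hpos : ∀ x, 0 < 1 + ‖W x‖ := fun x => by positivity
  have hc : AEStronglyMeasurable fun x => (1 + ‖W x‖)⁻¹ :=
    ((hW.norm.const_add 1).aemeasurable.inv).aestronglyMeasurable
  have hc1 : ∀ x, ‖(1 + ‖W x‖)⁻¹‖ ≤ 1 := fun x => by
    rw [Real.norm_of_nonneg (by positivity)]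
    exact inv_le_one_of_one_le₀ (by simp)
  have hu : MemLp (fun x => (1 + ‖W x‖)⁻¹ • g x) 2 volume := by
    refine (Lp.memLp g).mono (hc.smul (Lp.aestronglyMeasurable g)) (ae_of_all _ fun x => ?_)
    rw [norm_smul]
    exact mul_le_of_le_one_left (norm_nonneg _) (hc1 x)
  have hWu : MemLp (fun x => W x ((1 + ‖W x‖)⁻¹ • g x)) 2 volume := by
    refine (Lp.memLp g).mono (aestronglyMeasurable_apply hW hu.1) (ae_of_all _ fun x => ?_)
    refine ((W x).le_opNorm _).trans ?_
    rw [norm_smul, Real.norm_of_nonneg (by have := hpos x; positivity), ← mul_assoc, ← div_eq_mul_inv]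
    refine mul_le_of_le_one_left (norm_nonneg _) ?_
    rw [div_le_one (hpos x)]
    linarith
  have hmem : hu.toLp _ ∈ (mulOp W).domain := (memLp_mulFun_congr W hu.coeFn_toLp).2 hWu
  have h0 := hg _ hmem
  rw [L2.inner_def] at h0
  have h1 : ∫ x, (1 + ‖W x‖)⁻¹ * ‖g x‖ ^ 2 = 0 := by
    rw [← Complex.ofReal_eq_zero, ← integral_complex_ofReal, ← h0]
    refine integral_congr_ae ?_
    filter_upwards [hu.coeFn_toLp] with x hx
    rw [hx, inner_smul_left_eq_smul, inner_self_eq_norm_sq_to_K]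
    simp
  rw [integral_eq_zero_iff_of_nonneg (fun x => by have := hpos x; positivity)] at h1
  · refine Lp.ext ?_
    filter_upwards [h1, Lp.coeFn_zero Spinor 2 (volume : Measure ℝ)] with x hx hx0
    rw [hx0]
    have := (hpos x).ne'
    simpa [this] using hx
  · refine Integrable.mono' (Lp.memLp g).norm.integrable_sq
      (hc.mul ((Lp.aestronglyMeasurable g).norm.pow 2)) (ae_of_all _ fun x => ?_)
    rw [norm_mul, Real.norm_of_nonneg (sq_nonneg ‖g x‖)]
    exact mul_le_of_le_one_left (sq_nonneg _) (hc1 x)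

end MulOp

/-! ### Cauchy-Schwarz and the `L²` norm as an integral -/

section CauchySchwarz

variable {α E F : Type*} [MeasurableSpace α] {μ : Measure α} [NormedAddCommGroup E]
  [NormedAddCommGroup F]

theorem integral_norm_mul_norm_le_sqrt {f : α → E} {g : α → F} (hf : MemLp f 2 μ)
    (hg : MemLp g 2 μ) :
    ∫ x, ‖f x‖ * ‖g x‖ ∂μ ≤ √(∫ x, ‖f x‖ ^ 2 ∂μ) * √(∫ x, ‖g x‖ ^ 2 ∂μ) := by
  have h := integral_mul_norm_le_Lp_mul_Lq (μ := μ) (f := fun x => ‖f x‖) (g := fun x => ‖g x‖)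
    Real.HolderConjugate.two_two (by simpa using hf.norm) (by simpa using hg.norm)
  simpa [Real.sqrt_eq_rpow] using h

theorem integrable_norm_mul_norm {f : α → E} {g : α → F} (hf : MemLp f 2 μ)
    (hg : MemLp g 2 μ) : Integrable (fun x => ‖f x‖ * ‖g x‖) μ :=
  hf.norm.integrable_mul hg.norm

theorem norm_sq_eq_integral [InnerProductSpace ℂ E] (f : Lp E 2 μ) :
    ‖f‖ ^ 2 = ∫ x, ‖f x‖ ^ 2 ∂μ := by
  have h : ((‖f‖ ^ 2 : ℝ) : ℂ) = ((∫ x, ‖f x‖ ^ 2 ∂μ : ℝ) : ℂ) := by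
    rw [← integral_complex_ofReal, Complex.ofReal_pow]
    refine (inner_self_eq_norm_sq_to_K (𝕜 := ℂ) f).symm.trans ?_
    rw [L2.inner_def]
    refine integral_congr_ae (ae_of_all _ fun x => ?_)
    simp [inner_self_eq_norm_sq_to_K]
  exact_mod_cast h

theorem norm_eq_sqrt_integral [InnerProductSpace ℂ E] (f : Lp E 2 μ) :
    ‖f‖ = √(∫ x, ‖f x‖ ^ 2 ∂μ) := by
  rw [← norm_sq_eq_integral, Real.sqrt_sq (norm_nonneg _)]

end CauchySchwarz

/-! ### Convolution operators on `L²` and their adjoints -/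

section Convolution

/-- Bounded integrable functions, as kernels of convolution operators. -/
structure IsConvKernel (c : ℝ → ℂ) : Prop where
  integrable : Integrable c
  bounded : ∃ M, ∀ t, ‖c t‖ ≤ M

variable {c : ℝ → ℂ}

theorem IsConvKernel.memLp (hc : IsConvKernel c) : MemLp c 2 := by
  obtain ⟨M, hM⟩ := hc.bounded
  rw [memLp_two_iff_integrable_sq_norm hc.integrable.1]
  have := hc.integrable.norm.bdd_mul (c := M) hc.integrable.norm.1
    (ae_of_all _ fun t => by simpa using hM t)
  simpa [sq] using this

theorem IsConvKernel.memLp_comp (hc : IsConvKernel c) (x : ℝ) :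
    MemLp (fun y => c (x - y)) 2 :=
  hc.memLp.comp_measurePreserving (Measure.measurePreserving_sub_left volume x)

variable {E : Type*} [NormedAddCommGroup E] [InnerProductSpace ℂ E] {f g : ℝ → E}

/-- The convolution of a scalar kernel and a vector-valued function. -/
def convFun (c : ℝ → ℂ) (f : ℝ → E) (x : ℝ) : E := ∫ y, c (x - y) • f y

theorem convFun_congr (h : f =ᵐ[volume] g) : convFun c f = convFun c g := by
  ext x
  exact integral_congr_ae (by filter_upwards [h] with y hy; rw [hy])

theorem IsConvKernel.integrable_smul (hc : IsConvKernel c) (hf : MemLp f 2) (x : ℝ) :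
    Integrable (fun y => c (x - y) • f y) := by
  rw [← memLp_one_iff_integrable]
  exact hf.smul (hc.memLp_comp x)

theorem IsConvKernel.aestronglyMeasurable_prod (hc : IsConvKernel c) (hf : AEStronglyMeasurable f) :
    AEStronglyMeasurable (fun p : ℝ × ℝ => c (p.1 - p.2) • f p.2) (volume.prod volume) :=
  hf.convolution_integrand (ContinuousLinearMap.lsmul ℝ ℂ).flip hc.integrable.1

theorem IsConvKernel.integrable_prod {F : Type*} [NormedAddCommGroup F] {f : ℝ → F}
    (hc : IsConvKernel c) (hf : MemLp f 2) :
    Integrable (fun p : ℝ × ℝ => ‖c (p.1 - p.2)‖ * ‖f p.2‖ ^ 2) (volume.prod volume) :=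
  (hf.norm.integrable_sq).convolution_integrand (ContinuousLinearMap.mul ℝ ℝ).flip
    hc.integrable.norm

theorem IsConvKernel.integral_integral {F : Type*} [NormedAddCommGroup F] {f : ℝ → F}
    (hc : IsConvKernel c) (hf : MemLp f 2) :
    ∫ x, ∫ y, ‖c (x - y)‖ * ‖f y‖ ^ 2 = (∫ t, ‖c t‖) * ∫ y, ‖f y‖ ^ 2 := by
  rw [mul_comm]
  have := integral_convolution (ContinuousLinearMap.mul ℝ ℝ) hf.norm.integrable_sq
    hc.integrable.norm
  simpa [convolution_def, mul_comm] using this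

/-- Cauchy-Schwarz after splitting `|c| = √|c| · √|c|`. Integrating the result in `x` gives Young's
inequality with constant `‖c‖₁`. -/
theorem IsConvKernel.norm_convFun_sq_le (hc : IsConvKernel c) (hf : MemLp f 2) (x : ℝ) :
    ‖convFun c f x‖ ^ 2 ≤ (∫ t, ‖c t‖) * ∫ y, ‖c (x - y)‖ * ‖f y‖ ^ 2 := by
  obtain ⟨M, hM⟩ := hc.bounded
  have hcx : AEStronglyMeasurable fun y => c (x - y) := (hc.memLp_comp x).1
  have hcs : AEStronglyMeasurable fun y => √‖c (x - y)‖ :=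
    Real.continuous_sqrt.comp_aestronglyMeasurable hcx.norm
  have h1 : MemLp (fun y => √‖c (x - y)‖) 2 := by
    rw [memLp_two_iff_integrable_sq_norm hcs]
    simpa [Real.sq_sqrt] using (hc.integrable.comp_sub_left x).norm
  have h2 : MemLp (fun y => √‖c (x - y)‖ * ‖f y‖) 2 := by
    refine (hf.norm.const_mul √M).mono (hcs.mul hf.1.norm) (ae_of_all _ fun y => ?_)
    simp only [norm_mul, norm_norm, Real.norm_of_nonneg (Real.sqrt_nonneg _)]
    gcongr
    exact hM _
  have h3 := integral_norm_mul_norm_le_sqrt h1 h2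
  have e1 : ∀ y, ‖√‖c (x - y)‖‖ * ‖√‖c (x - y)‖ * ‖f y‖‖ = ‖c (x - y) • f y‖ := fun y => by
    rw [norm_mul, Real.norm_of_nonneg (Real.sqrt_nonneg _), norm_norm, ← mul_assoc,
      Real.mul_self_sqrt (norm_nonneg _), norm_smul]
  have e2 : ∀ y, ‖√‖c (x - y)‖ * ‖f y‖‖ ^ 2 = ‖c (x - y)‖ * ‖f y‖ ^ 2 := fun y => by
    rw [norm_mul, Real.norm_of_nonneg (Real.sqrt_nonneg _), norm_norm, mul_pow,
      Real.sq_sqrt (norm_nonneg _)]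
  have e3 : ∀ y, ‖√‖c (x - y)‖‖ ^ 2 = ‖c (x - y)‖ := fun y => by
    rw [Real.norm_of_nonneg (Real.sqrt_nonneg _), Real.sq_sqrt (norm_nonneg _)]
  simp only [e1, e2, e3, integral_sub_left_eq_self (fun t => ‖c t‖)] at h3
  have h4 : ‖convFun c f x‖ ≤ _ := (norm_integral_le_integral_norm _).trans h3
  refine (pow_le_pow_left₀ (norm_nonneg _) h4 2).trans_eq ?_
  rw [mul_pow, Real.sq_sqrt (by positivity), Real.sq_sqrt (by positivity)]

theorem IsConvKernel.aestronglyMeasurable_convFun (hc : IsConvKernel c)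
    (hf : AEStronglyMeasurable f) : AEStronglyMeasurable (convFun c f) :=
  (hc.aestronglyMeasurable_prod hf).integral_prod_right'

theorem IsConvKernel.memLp_convFun (hc : IsConvKernel c) (hf : MemLp f 2) :
    MemLp (convFun c f) 2 := by
  have hm := hc.aestronglyMeasurable_convFun hf.1
  rw [memLp_two_iff_integrable_sq_norm hm]
  refine Integrable.mono' ((hc.integrable_prod hf).integral_prod_left.const_mul (∫ t, ‖c t‖))
    (hm.norm.pow 2) (ae_of_all _ fun x => ?_)
  rw [Real.norm_of_nonneg (by positivity)]
  exact hc.norm_convFun_sq_le hf x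

theorem IsConvKernel.integral_norm_convFun_sq_le (hc : IsConvKernel c) (hf : MemLp f 2) :
    ∫ x, ‖convFun c f x‖ ^ 2 ≤ (∫ t, ‖c t‖) ^ 2 * ∫ y, ‖f y‖ ^ 2 := by
  rw [sq (∫ t, ‖c t‖), mul_assoc, ← hc.integral_integral hf, ← integral_const_mul]
  exact integral_mono (hc.memLp_convFun hf).norm.integrable_sq
    ((hc.integrable_prod hf).integral_prod_left.const_mul _) (hc.norm_convFun_sq_le hf)

/-- Convolution with a fixed kernel as a bounded operator on `L²`. -/
def IsConvKernel.op (hc : IsConvKernel c) : Lp E 2 (volume : Measure ℝ) →L[ℂ] Lp E 2 (volume : Measure ℝ) :=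
  LinearMap.mkContinuous
    { toFun := fun f => (hc.memLp_convFun (Lp.memLp f)).toLp _
      map_add' := fun f g => by
        rw [← MemLp.toLp_add]
        congr 1
        rw [convFun_congr (Lp.coeFn_add f g)]
        ext x
        simp only [convFun, Pi.add_apply, smul_add]
        exact integral_add (hc.integrable_smul (Lp.memLp f) x) (hc.integrable_smul (Lp.memLp g) x)
      map_smul' := fun a f => by
        rw [RingHom.id_apply, ← MemLp.toLp_const_smul]
        congr 1
        rw [convFun_congr (Lp.coeFn_smul a f)]
        ext x
        simp only [convFun, Pi.smul_apply, smul_comm _ a]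
        exact integral_smul _ _ }
    (∫ t, ‖c t‖) fun f => by
      rw [← sq_le_sq₀ (norm_nonneg _) (by positivity), mul_pow, norm_sq_eq_integral,
        norm_sq_eq_integral]
      refine le_of_eq_of_le ?_ (hc.integral_norm_convFun_sq_le (Lp.memLp f))
      refine integral_congr_ae ?_
      filter_upwards [(hc.memLp_convFun (Lp.memLp f)).coeFn_toLp] with x hx
      rw [LinearMap.coe_mk, AddHom.coe_mk, hx]

theorem IsConvKernel.coeFn_op (hc : IsConvKernel c) (f : Lp E 2 (volume : Measure ℝ)) :
    hc.op f =ᵐ[volume] convFun c f :=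
  MemLp.coeFn_toLp (hc.memLp_convFun (Lp.memLp f))

theorem IsConvKernel.reflect (hc : IsConvKernel c) :
    IsConvKernel fun t => (starRingEnd ℂ) (c (-t)) where
  integrable := by
    refine hc.integrable.comp_neg.norm.mono' ?_ (ae_of_all _ fun t => by simp)
    exact Complex.continuous_conj.comp_aestronglyMeasurable hc.integrable.comp_neg.1
  bounded := by
    obtain ⟨M, hM⟩ := hc.bounded
    exact ⟨M, fun t => by simpa using hM (-t)⟩

/-- The inner product is dominated by `‖f‖² + ‖g‖²`, and each square times `|c(x - y)|` is
integrable on the plane. This justifies Fubini in `IsConvKernel.inner_op`. -/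
theorem IsConvKernel.integrable_inner_prod (hc : IsConvKernel c) (hf : MemLp f 2)
    (hg : MemLp g 2) :
    Integrable (fun p : ℝ × ℝ => c (p.1 - p.2) * inner ℂ (g p.1) (f p.2))
      (volume.prod volume) := by
  have h1 := hc.integrable_prod hf
  have h2 := (hc.reflect.integrable_prod hg).swap
  have h3 : AEStronglyMeasurable (fun p : ℝ × ℝ => c (p.1 - p.2) * inner ℂ (g p.1) (f p.2))
      (volume.prod volume) := by
    have := (hg.1.comp_fst (ν := (volume : Measure ℝ))).inner (𝕜 := ℂ)
      (hc.aestronglyMeasurable_prod hf.1)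
    simpa only [inner_smul_right] using this
  refine (h1.add h2).mono' h3 (ae_of_all _ fun p => ?_)
  simp only [Pi.add_apply, Function.comp_apply, Prod.fst_swap, Prod.snd_swap, neg_sub,
    RCLike.norm_conj, norm_mul]
  have h4 : ‖inner ℂ (g p.1) (f p.2)‖ ≤ ‖f p.2‖ ^ 2 + ‖g p.1‖ ^ 2 := by
    refine (norm_inner_le_norm _ _).trans ?_
    nlinarith [sq_nonneg (‖f p.2‖ - ‖g p.1‖), sq_nonneg (‖f p.2‖), sq_nonneg (‖g p.1‖)]
  rw [← mul_add]
  gcongr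

theorem IsConvKernel.inner_op [CompleteSpace E] (hc : IsConvKernel c)
    (f g : Lp E 2 (volume : Measure ℝ)) :
    inner ℂ g (hc.op f) = inner ℂ (hc.reflect.op g) f := by
  have hf := Lp.memLp f
  have hg := Lp.memLp g
  rw [L2.inner_def, L2.inner_def]
  have e1 : ∫ x, inner ℂ (g x) (hc.op f x) = ∫ x, ∫ y, c (x - y) * inner ℂ (g x) (f y) := by
    refine integral_congr_ae ?_
    filter_upwards [hc.coeFn_op f] with x hx
    rw [hx, convFun, ← integral_inner (hc.integrable_smul hf x)]
    simp only [inner_smul_right]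
  have e2 : ∫ y, inner ℂ (hc.reflect.op g y) (f y) =
      ∫ y, ∫ x, c (x - y) * inner ℂ (g x) (f y) := by
    refine integral_congr_ae ?_
    filter_upwards [hc.reflect.coeFn_op g] with y hy
    rw [hy, convFun, ← inner_conj_symm, ← integral_inner (hc.reflect.integrable_smul hg y),
      ← integral_conj]
    simp [inner_smul_right]
  rw [e1, e2]
  exact integral_integral_swap (hc.integrable_inner_prod hf hg)

end Convolution

/-! ### Convolution and weak differentiation -/

section WeakDerivative

variable {c : ℝ → ℂ}

theorem norm_mul_mul_le (a b c : ℝ) (ha : 0 ≤ a) : a * (b * c) ≤ a * b ^ 2 + a * c ^ 2 := by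
  rw [← mul_add]
  gcongr
  nlinarith [sq_nonneg (b - c), sq_nonneg b, sq_nonneg c]

theorem IsConvKernel.integrable_test_prod (hc : IsConvKernel c) {f : ℝ → Spinor}
    (hf : MemLp f 2) {ψ : ℝ → ℝ} (hψ : MemLp ψ 2) :
    Integrable (fun p : ℝ × ℝ => ψ p.1 • c (p.1 - p.2) • f p.2) (volume.prod volume) := by
  have h1 := hc.integrable_prod hf
  have h2 := (hc.reflect.integrable_prod hψ).swap
  refine (h2.add h1).mono' (hψ.1.comp_fst.smul (hc.aestronglyMeasurable_prod hf.1))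
    (ae_of_all _ fun p => ?_)
  simp only [Pi.add_apply, Function.comp_apply, Prod.fst_swap, Prod.snd_swap, neg_sub,
    RCLike.norm_conj, norm_smul]
  refine le_of_eq_of_le ?_ (norm_mul_mul_le _ _ _ (norm_nonneg _))
  ring

theorem IsConvKernel.integrable_test_prod' (hc : IsConvKernel c) {f : ℝ → Spinor}
    (hf : MemLp f 2) {ψ : ℝ → ℝ} (hψ : MemLp ψ 2) :
    Integrable (fun p : ℝ × ℝ => ψ p.1 • c p.2 • f (p.1 - p.2)) (volume.prod volume) := by
  have h1 : Integrable (fun p : ℝ × ℝ => ‖c p.2‖ * ‖f (p.1 - p.2)‖ ^ 2) (volume.prod volume) :=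
    hc.integrable.norm.convolution_integrand (ContinuousLinearMap.mul ℝ ℝ) hf.norm.integrable_sq
  have h2 : Integrable (fun p : ℝ × ℝ => ‖ψ p.1‖ ^ 2 * ‖c p.2‖) (volume.prod volume) :=
    hψ.norm.integrable_sq.mul_prod hc.integrable.norm
  have h3 : AEStronglyMeasurable (fun p : ℝ × ℝ => c p.2 • f (p.1 - p.2)) (volume.prod volume) :=
    hc.integrable.1.convolution_integrand (ContinuousLinearMap.lsmul ℝ ℂ) hf.1
  refine (h2.add h1).mono' (hψ.1.comp_fst.smul h3) (ae_of_all _ fun p => ?_)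
  simp only [Pi.add_apply, norm_smul]
  refine le_of_eq_of_le ?_ ((norm_mul_mul_le _ _ _ (norm_nonneg (c p.2))).trans_eq
    (congrArg (· + _) (mul_comm _ _)))
  ring

/-- This form puts the test function on the kernel, so that weak derivatives of `c * f` reduce to
those of `c`. -/
theorem IsConvKernel.integral_smul_op (hc : IsConvKernel c) (f : L2) {ψ : ℝ → ℝ}
    (hψ : MemLp ψ 2) :
    ∫ x, ψ x • hc.op f x = ∫ y, (∫ x, ψ x • c (x - y)) • f y := by
  have e1 : ∫ x, ψ x • hc.op f x = ∫ x, ∫ y, ψ x • c (x - y) • f y := by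
    refine integral_congr_ae ?_
    filter_upwards [hc.coeFn_op f] with x hx
    rw [hx, convFun, integral_smul]
  rw [e1, integral_integral_swap (hc.integrable_test_prod (Lp.memLp f) hψ)]
  congr 1 with y
  rw [← integral_smul_const]
  simp only [smul_assoc]

/-- This form puts a translate of the test function on `f`, so that the weak derivative can be
passed to `f`. -/
theorem IsConvKernel.integral_smul_op' (hc : IsConvKernel c) (f : L2) {ψ : ℝ → ℝ}
    (hψ : MemLp ψ 2) :
    ∫ x, ψ x • hc.op f x = ∫ t, c t • ∫ x, ψ (x + t) • f x := by
  have e1 : ∫ x, ψ x • hc.op f x = ∫ x, ∫ t, ψ x • c t • f (x - t) := by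
    refine integral_congr_ae ?_
    filter_upwards [hc.coeFn_op f] with x hx
    rw [hx, convFun, integral_smul, ← integral_sub_left_eq_self _ _ x]
    simp only [sub_sub_cancel]
  rw [e1, integral_integral_swap (hc.integrable_test_prod' (Lp.memLp f) hψ)]
  congr 1 with t
  simp only [smul_comm (ψ _)]
  rw [integral_smul, ← integral_add_right_eq_self _ t]
  simp only [add_sub_cancel_right]

theorem memLp_of_test {φ : ℝ → ℝ} (hφ : Continuous φ) (hc : HasCompactSupport φ) :
    MemLp φ 2 (volume : Measure ℝ) := hφ.memLp_of_hasCompactSupport hc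

/-- Convolution operators commute with weak differentiation. -/
theorem IsWeakDeriv.op (hc : IsConvKernel c) {f g : L2} (h : IsWeakDeriv f g) :
    IsWeakDeriv (hc.op f) (hc.op g) := by
  intro φ hφ hφc
  rw [hc.integral_smul_op' f (memLp_of_test (hφ.continuous_deriv (by simp)) hφc.deriv),
    hc.integral_smul_op' g (memLp_of_test hφ.continuous hφc), ← integral_neg]
  congr 1 with t : 1
  have h1 := h (fun x => φ (x + t)) (hφ.comp (contDiff_id.add contDiff_const))
    (hφc.comp_homeomorph (Homeomorph.addRight t))
  simp only [deriv_comp_add_const] at h1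
  rw [h1, smul_neg]

end WeakDerivative

/-! ### The kernels of the Green's function and their distributional derivatives -/

section ExponentialKernels

variable {k : ℂ}

/-- The kernel `exp(i k |t|)`. -/
def expKer (k : ℂ) (t : ℝ) : ℂ := Complex.exp (Complex.I * k * (|t| : ℝ))

/-- The kernel `sgn(t) exp(i k |t|)`. -/
def sgnKer (k : ℂ) (t : ℝ) : ℂ := (Real.sign t : ℂ) * expKer k t

theorem norm_expKer (k : ℂ) (t : ℝ) : ‖expKer k t‖ = Real.exp (-k.im * |t|) := by
  rw [expKer, Complex.norm_exp]
  simp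

theorem continuous_expKer (k : ℂ) : Continuous (expKer k) := by
  unfold expKer
  fun_prop

theorem abs_sign_le (t : ℝ) : |Real.sign t| ≤ 1 := by
  rcases Real.sign_apply_eq t with h | h | h <;> simp [h]

theorem norm_sgnKer_le (k : ℂ) (t : ℝ) : ‖sgnKer k t‖ ≤ ‖expKer k t‖ := by
  rw [sgnKer, norm_mul, Complex.norm_real]
  exact mul_le_of_le_one_left (norm_nonneg _) (abs_sign_le t)

theorem measurable_sign : Measurable Real.sign := by
  unfold Real.sign
  exact Measurable.ite measurableSet_Iio measurable_const
    (Measurable.ite measurableSet_Ioi measurable_const measurable_const)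

theorem integrable_exp_neg_mul_abs {a : ℝ} (ha : 0 < a) :
    Integrable fun t : ℝ => Real.exp (-a * |t|) := by
  have h := integrableOn_exp_mul_Ioi (neg_lt_zero.2 ha) 0
  have h1 : IntegrableOn (fun t : ℝ => Real.exp (-a * |t|)) (Ioi 0) :=
    h.congr_fun (fun t ht => by rw [abs_of_pos ht]) measurableSet_Ioi
  have h2 : IntegrableOn (fun t : ℝ => Real.exp (-a * |t|)) (Iic 0) := by
    rw [← integrableOn_Ici_iff_integrableOn_Ioi] at h1
    have := h1.comp_neg
    simpa using this
  rw [← integrableOn_univ, ← Iic_union_Ioi (a := (0 : ℝ))]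
  exact h2.union h1

theorem integral_exp_neg_mul_abs {a : ℝ} (ha : 0 < a) :
    ∫ t : ℝ, Real.exp (-a * |t|) = 2 / a := by
  rw [integral_comp_abs (f := fun t => Real.exp (-a * t)), integral_exp_mul_Ioi (neg_lt_zero.2 ha)]
  simp
  ring

theorem isConvKernel_expKer (hk : 0 < k.im) : IsConvKernel (expKer k) where
  integrable := by
    refine (integrable_exp_neg_mul_abs hk).mono' (continuous_expKer k).aestronglyMeasurable
      (ae_of_all _ fun t => (norm_expKer k t).le)
  bounded := ⟨1, fun t => by
    rw [norm_expKer, Real.exp_le_one_iff, neg_mul, neg_nonpos]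
    positivity⟩

theorem isConvKernel_sgnKer (hk : 0 < k.im) : IsConvKernel (sgnKer k) where
  integrable := by
    refine (isConvKernel_expKer hk).integrable.norm.mono' ?_
      (ae_of_all _ fun t => norm_sgnKer_le k t)
    exact ((Complex.measurable_ofReal.comp measurable_sign).mul
      (continuous_expKer k).measurable).aestronglyMeasurable
  bounded := by
    obtain ⟨M, hM⟩ := (isConvKernel_expKer hk).bounded
    exact ⟨M, fun t => (norm_sgnKer_le k t).trans (hM t)⟩

theorem integrable_test_mul {φ : ℝ → ℝ} (hφ : Continuous φ) (hφc : HasCompactSupport φ)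
    {g : ℝ → ℂ} (hg : Continuous g) : Integrable fun x => φ x • g x :=
  (hφ.smul hg).integrable_of_hasCompactSupport hφc.smul_right

theorem deriv_smul_exp {φ : ℝ → ℝ} (hφ : ContDiff ℝ ∞ φ) (a : ℂ) (y x : ℝ) :
    deriv (fun x => φ x • Complex.exp (a * ((x - y : ℝ) : ℂ))) x =
      deriv φ x • Complex.exp (a * ((x - y : ℝ) : ℂ)) +
        a * φ x • Complex.exp (a * ((x - y : ℝ) : ℂ)) := by
  have h1 : HasDerivAt φ (deriv φ x) x := (hφ.differentiable (by simp) x).hasDerivAt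
  have h2 : HasDerivAt (fun x : ℝ => Complex.exp (a * ((x - y : ℝ) : ℂ)))
      (Complex.exp (a * ((x - y : ℝ) : ℂ)) * (a * 1)) x := by
    refine HasDerivAt.cexp (HasDerivAt.const_mul a ?_)
    simpa using ((hasDerivAt_id x).sub_const y).ofReal_comp
  rw [(h1.fun_smul h2).deriv]
  simp only [Complex.real_smul]
  ring

theorem integral_Ioi_deriv_smul_exp {φ : ℝ → ℝ} (hφ : ContDiff ℝ ∞ φ)
    (hφc : HasCompactSupport φ) (a : ℂ) (y : ℝ) :
    ∫ x in Ioi y, deriv φ x • Complex.exp (a * ((x - y : ℝ) : ℂ)) =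
      -(φ y : ℂ) - a * ∫ x in Ioi y, φ x • Complex.exp (a * ((x - y : ℝ) : ℂ)) := by
  have hs : ContDiff ℝ 1 (fun x => φ x • Complex.exp (a * ((x - y : ℝ) : ℂ))) := by
    refine (hφ.of_le (by simp)).smul (ContDiff.cexp (contDiff_const.mul ?_))
    exact Complex.ofRealCLM.contDiff.comp (contDiff_id.sub contDiff_const)
  have h := HasCompactSupport.integral_Ioi_deriv_eq hs hφc.smul_right y
  simp only [deriv_smul_exp hφ] at h
  rw [integral_add, integral_const_mul] at h
  · simp only [sub_self, Complex.ofReal_zero, mul_zero, Complex.exp_zero, Complex.real_smul,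
      mul_one] at h ⊢
    linear_combination h
  · exact (integrable_test_mul (hφ.continuous_deriv (by simp)) hφc.deriv
      (by fun_prop)).integrableOn
  · exact ((integrable_test_mul hφ.continuous hφc (by fun_prop)).const_mul _).integrableOn

theorem integral_Iic_deriv_smul_exp {φ : ℝ → ℝ} (hφ : ContDiff ℝ ∞ φ)
    (hφc : HasCompactSupport φ) (a : ℂ) (y : ℝ) :
    ∫ x in Iic y, deriv φ x • Complex.exp (a * ((x - y : ℝ) : ℂ)) =
      (φ y : ℂ) - a * ∫ x in Iic y, φ x • Complex.exp (a * ((x - y : ℝ) : ℂ)) := by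
  have hs : ContDiff ℝ 1 (fun x => φ x • Complex.exp (a * ((x - y : ℝ) : ℂ))) := by
    refine (hφ.of_le (by simp)).smul (ContDiff.cexp (contDiff_const.mul ?_))
    exact Complex.ofRealCLM.contDiff.comp (contDiff_id.sub contDiff_const)
  have h := HasCompactSupport.integral_Iic_deriv_eq hs hφc.smul_right y
  simp only [deriv_smul_exp hφ] at h
  rw [integral_add, integral_const_mul] at h
  · simp only [sub_self, Complex.ofReal_zero, mul_zero, Complex.exp_zero, Complex.real_smul,
      mul_one] at h ⊢
    linear_combination h
  · exact (integrable_test_mul (hφ.continuous_deriv (by simp)) hφc.deriv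
      (by fun_prop)).integrableOn
  · exact ((integrable_test_mul hφ.continuous hφc (by fun_prop)).const_mul _).integrableOn

theorem expKer_of_lt {x y : ℝ} (h : y < x) :
    expKer k (x - y) = Complex.exp (Complex.I * k * ((x - y : ℝ) : ℂ)) := by
  rw [expKer, abs_of_pos (sub_pos.2 h)]

theorem expKer_of_gt {x y : ℝ} (h : x < y) :
    expKer k (x - y) = Complex.exp (-(Complex.I * k) * ((x - y : ℝ) : ℂ)) := by
  rw [expKer, abs_of_neg (sub_neg.2 h)]
  push_cast
  ring_nf

theorem sgnKer_of_lt {x y : ℝ} (h : y < x) :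
    sgnKer k (x - y) = Complex.exp (Complex.I * k * ((x - y : ℝ) : ℂ)) := by
  rw [sgnKer, expKer_of_lt h, Real.sign_of_pos (sub_pos.2 h)]
  simp

theorem sgnKer_of_gt {x y : ℝ} (h : x < y) :
    sgnKer k (x - y) = -Complex.exp (-(Complex.I * k) * ((x - y : ℝ) : ℂ)) := by
  rw [sgnKer, expKer_of_gt h, Real.sign_of_neg (sub_neg.2 h)]
  simp

theorem integral_smul_expKer {φ : ℝ → ℝ} (hφ : Continuous φ) (hφc : HasCompactSupport φ)
    (y : ℝ) : ∫ x, φ x • expKer k (x - y) =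
      (∫ x in Iic y, φ x • Complex.exp (-(Complex.I * k) * ((x - y : ℝ) : ℂ))) +
        ∫ x in Ioi y, φ x • Complex.exp (Complex.I * k * ((x - y : ℝ) : ℂ)) := by
  have hi : Integrable fun x => φ x • expKer k (x - y) :=
    integrable_test_mul hφ hφc ((continuous_expKer k).comp (by fun_prop))
  rw [← intervalIntegral.integral_Iic_add_Ioi hi.integrableOn hi.integrableOn,
    integral_Iic_eq_integral_Iio, integral_Iic_eq_integral_Iio]
  congr 1
  · exact setIntegral_congr_fun measurableSet_Iio fun x hx => by simp only [expKer_of_gt hx]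
  · exact setIntegral_congr_fun measurableSet_Ioi fun x hx => by simp only [expKer_of_lt hx]

theorem integral_smul_sgnKer (hk : 0 < k.im) {φ : ℝ → ℝ} (hφ : Continuous φ)
    (hφc : HasCompactSupport φ) (y : ℝ) : ∫ x, φ x • sgnKer k (x - y) =
      -(∫ x in Iic y, φ x • Complex.exp (-(Complex.I * k) * ((x - y : ℝ) : ℂ))) +
        ∫ x in Ioi y, φ x • Complex.exp (Complex.I * k * ((x - y : ℝ) : ℂ)) := by
  have hi : Integrable fun x => φ x • sgnKer k (x - y) := by
    have h := integrable_test_mul hφ hφc ((continuous_expKer k).comp (continuous_sub_right y))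
    refine h.mono (hφ.aestronglyMeasurable.smul
      ((isConvKernel_sgnKer hk).integrable.comp_sub_right y).1) (ae_of_all _ fun x => ?_)
    rw [norm_smul, norm_smul]
    gcongr
    exact norm_sgnKer_le k _
  -- The point `x = y` has to be dropped: there `sgnKer` vanishes and the exponential does not.
  rw [← intervalIntegral.integral_Iic_add_Ioi hi.integrableOn hi.integrableOn,
    integral_Iic_eq_integral_Iio, integral_Iic_eq_integral_Iio, ← integral_neg]
  congr 1
  · exact setIntegral_congr_fun measurableSet_Iio fun x hx => by
      simp only [sgnKer_of_gt hx, smul_neg]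
  · exact setIntegral_congr_fun measurableSet_Ioi fun x hx => by simp only [sgnKer_of_lt hx]

/-- This is `(e^{ik|t|})' = ik sgn(t) e^{ik|t|}` in the sense of distributions: the boundary terms
`±φ(y)` of the two half-lines cancel. -/
theorem integral_deriv_smul_expKer (hk : 0 < k.im) {φ : ℝ → ℝ} (hφ : ContDiff ℝ ∞ φ)
    (hφc : HasCompactSupport φ) (y : ℝ) :
    ∫ x, deriv φ x • expKer k (x - y) = -(Complex.I * k) * ∫ x, φ x • sgnKer k (x - y) := by
  rw [integral_smul_expKer (hφ.continuous_deriv (by simp)) hφc.deriv,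
    integral_smul_sgnKer hk hφ.continuous hφc, integral_Ioi_deriv_smul_exp hφ hφc,
    integral_Iic_deriv_smul_exp hφ hφc]
  ring

/-- This is `(sgn(t) e^{ik|t|})' = 2δ + ik e^{ik|t|}`: the boundary terms now add up, and the delta
function is what produces the identity in `(H₀ - z) R₀(z) = 1`. -/
theorem integral_deriv_smul_sgnKer (hk : 0 < k.im) {φ : ℝ → ℝ} (hφ : ContDiff ℝ ∞ φ)
    (hφc : HasCompactSupport φ) (y : ℝ) :
    ∫ x, deriv φ x • sgnKer k (x - y) =
      -2 * φ y - (Complex.I * k) * ∫ x, φ x • expKer k (x - y) := by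
  rw [integral_smul_sgnKer hk (hφ.continuous_deriv (by simp)) hφc.deriv,
    integral_smul_expKer hφ.continuous hφc, integral_Ioi_deriv_smul_exp hφ hφc,
    integral_Iic_deriv_smul_exp hφ hφc]
  ring

/-- Convolution with `exp(i k |t|)`. -/
def expOp (hk : 0 < k.im) : L2 →L[ℂ] L2 := (isConvKernel_expKer hk).op

/-- Convolution with `sgn(t) exp(i k |t|)`. -/
def sgnOp (hk : 0 < k.im) : L2 →L[ℂ] L2 := (isConvKernel_sgnKer hk).op

theorem isWeakDeriv_expOp (hk : 0 < k.im) (f : L2) :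
    IsWeakDeriv (expOp hk f) ((Complex.I * k) • sgnOp hk f) := by
  intro φ hφ hφc
  have e : (fun x => φ x • ((Complex.I * k) • sgnOp hk f : L2) x) =ᵐ[volume]
      fun x => (Complex.I * k) • φ x • sgnOp hk f x := by
    filter_upwards [Lp.coeFn_smul (Complex.I * k) (sgnOp hk f)] with x hx
    rw [hx, Pi.smul_apply, smul_comm]
  rw [integral_congr_ae e, integral_smul, sgnOp, expOp,
    (isConvKernel_sgnKer hk).integral_smul_op f (memLp_of_test hφ.continuous hφc),
    (isConvKernel_expKer hk).integral_smul_op f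
      (memLp_of_test (hφ.continuous_deriv (by simp)) hφc.deriv),
    ← integral_smul, ← integral_neg]
  congr 1 with y : 1
  rw [integral_deriv_smul_expKer hk hφ hφc, neg_mul, neg_smul, mul_smul]

theorem isWeakDeriv_sgnOp (hk : 0 < k.im) (f : L2) :
    IsWeakDeriv (sgnOp hk f) ((2 : ℂ) • f + (Complex.I * k) • expOp hk f) := by
  intro φ hφ hφc
  have e : (fun x => φ x • ((2 : ℂ) • f + (Complex.I * k) • expOp hk f : L2) x) =ᵐ[volume]
      fun x => (2 : ℂ) • φ x • f x + (Complex.I * k) • φ x • expOp hk f x := by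
    filter_upwards [Lp.coeFn_smul (Complex.I * k) (expOp hk f), Lp.coeFn_smul (2 : ℂ) f,
      Lp.coeFn_add ((2 : ℂ) • f) ((Complex.I * k) • expOp hk f)] with x h1 h2 h3
    rw [h3, Pi.add_apply, h1, h2, Pi.smul_apply, Pi.smul_apply, smul_add, smul_comm (φ x),
      smul_comm (φ x)]
  have i1 := integrable_test_smul f hφ.continuous hφc
  have i2 : Integrable fun y => (∫ x, φ x • expKer k (x - y)) • f y := by
    have := ((isConvKernel_expKer hk).integrable_test_prod (Lp.memLp f)
      (memLp_of_test hφ.continuous hφc)).integral_prod_right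
    refine this.congr (ae_of_all _ fun y => ?_)
    simp only [← integral_smul_const, smul_assoc]
  have i1' : Integrable fun y => (2 : ℂ) • φ y • f y := i1.smul (2 : ℂ)
  have i2' : Integrable fun y => (Complex.I * k) • (∫ x, φ x • expKer k (x - y)) • f y :=
    i2.smul (Complex.I * k)
  have i3 : Integrable fun y => (Complex.I * k) • φ y • expOp hk f y :=
    (integrable_test_smul (expOp hk f) hφ.continuous hφc).smul (Complex.I * k)
  rw [integral_congr_ae e, integral_add i1' i3, integral_smul,
    integral_smul, sgnOp, expOp,
    (isConvKernel_expKer hk).integral_smul_op f (memLp_of_test hφ.continuous hφc),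
    (isConvKernel_sgnKer hk).integral_smul_op f
      (memLp_of_test (hφ.continuous_deriv (by simp)) hφc.deriv),
    ← integral_smul, ← integral_smul, ← integral_add i1' i2',
    ← integral_neg]
  congr 1 with y : 1
  rw [integral_deriv_smul_sgnKer hk hφ hφc, RCLike.real_smul_eq_coe_smul (K := ℂ) (φ y) (f y)]
  simp only [Complex.coe_algebraMap]
  module

/-- Convolution commutes with the derivative, so the derivative moves from the function to the
kernel. With `sgnOp_of_isWeakDeriv`, this makes the Green's operator a left inverse on `H¹`. -/
theorem expOp_of_isWeakDeriv (hk : 0 < k.im) {f g : L2} (h : IsWeakDeriv f g) :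
    expOp hk g = (Complex.I * k) • sgnOp hk f :=
  (h.op (isConvKernel_expKer hk)).unique (isWeakDeriv_expOp hk f)

theorem sgnOp_of_isWeakDeriv (hk : 0 < k.im) {f g : L2} (h : IsWeakDeriv f g) :
    sgnOp hk g = (2 : ℂ) • f + (Complex.I * k) • expOp hk f :=
  (h.op (isConvKernel_sgnKer hk)).unique (isWeakDeriv_sgnOp hk f)

end ExponentialKernels

/-! ### The wave number `k(z)` off the half-lines -/

section WaveNumber

variable {m : ℝ} {z : ℂ}

/-- The real half-lines `(-∞, -m] ∪ [m, ∞)` as a subset of the complex plane. -/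
def halfLines (m : ℝ) : Set ℂ := (fun x : ℝ => (x : ℂ)) '' (Iic (-m) ∪ Ici m)

theorem kFun_sq (m : ℝ) (z : ℂ) : kFun m z ^ 2 = z ^ 2 - (m : ℂ) ^ 2 := by
  have h : Complex.sqrt (-(z ^ 2 - (m : ℂ) ^ 2)) ^ 2 = -(z ^ 2 - (m : ℂ) ^ 2) := by
    simp [Complex.sqrt]
  rw [kFun, mul_pow, h, Complex.I_sq]
  ring

theorem mem_halfLines_of_sq {m : ℝ} {z : ℂ} {r : ℝ} (hr : 0 ≤ r)
    (h : z ^ 2 = (m : ℂ) ^ 2 + r) : z ∈ halfLines m := by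
  have h2 := congrArg Complex.im h
  have h1 := congrArg Complex.re h
  simp [sq] at h1 h2
  have him : z.im = 0 := by
    by_contra hne
    have hre : z.re = 0 := by
      have : z.re * z.im = 0 := by linarith
      exact (mul_eq_zero.1 this).resolve_right hne
    rw [hre] at h1
    nlinarith [mul_self_pos.2 hne, mul_self_nonneg m]
  refine ⟨z.re, ?_, Complex.ext (by simp) (by simp [him])⟩
  rw [him] at h1
  have h3 : |m| ≤ |z.re| := sq_le_sq.1 (by nlinarith)
  rcases le_abs.1 ((le_abs_self m).trans h3) with h4 | h4
  · exact Or.inr h4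
  · exact Or.inl (by simpa using neg_le_neg h4)

/-- `Im k` is the real part of the principal root of `w = m² - z²`. It vanishes only for `w = -|w|`,
which means `z² = m² + |w|` and puts `z` on a half-line. -/
theorem kFun_im_pos (hz : z ∉ halfLines m) : 0 < (kFun m z).im := by
  have h : (kFun m z).im = (Complex.sqrt (-(z ^ 2 - (m : ℂ) ^ 2))).re := by simp [kFun]
  set w := -(z ^ 2 - (m : ℂ) ^ 2) with hw
  rw [h, Complex.sqrt, Complex.cpow_inv_two_re, Real.sqrt_pos]
  have h1 : 0 ≤ ‖w‖ + w.re := by linarith [neg_abs_le w.re, Complex.abs_re_le_norm w]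
  rcases h1.lt_or_eq with h1 | h1
  · positivity
  refine absurd (mem_halfLines_of_sq (norm_nonneg w) ?_) hz
  have h2 : w.im = 0 := by
    have h3 := Complex.sq_norm w
    rw [Complex.normSq_apply] at h3
    have h4 : ‖w‖ = -w.re := by linarith
    rw [h4] at h3
    nlinarith
  have h5 : w = -((‖w‖ : ℝ) : ℂ) := by
    clear_value w
    refine Complex.ext ?_ (by simp [h2])
    rw [Complex.neg_re, Complex.ofReal_re]
    linarith
  linear_combination hw - h5

theorem conj_mem_halfLines_iff : (starRingEnd ℂ) z ∈ halfLines m ↔ z ∈ halfLines m := by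
  constructor
  · rintro ⟨x, hx, h⟩
    exact ⟨x, hx, by rw [← Complex.conj_conj z, ← h]; simp⟩
  · rintro ⟨x, hx, rfl⟩
    exact ⟨x, hx, by simp⟩

/-- Both sides are square roots of the same number; the sign is decided by the positive imaginary
part. -/
theorem kFun_conj (hz : z ∉ halfLines m) :
    kFun m ((starRingEnd ℂ) z) = -(starRingEnd ℂ) (kFun m z) := by
  have h : kFun m ((starRingEnd ℂ) z) ^ 2 = (starRingEnd ℂ) (kFun m z) ^ 2 := by
    rw [← map_pow, kFun_sq, kFun_sq]
    simp
  rcases sq_eq_sq_iff_eq_or_eq_neg.1 h with h1 | h1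
  · have h2 := kFun_im_pos (fun h => hz (conj_mem_halfLines_iff.1 h))
    have h3 := kFun_im_pos hz
    rw [h1, Complex.conj_im] at h2
    linarith
  · exact h1

theorem kFun_ne_zero (hz : z ∉ halfLines m) : kFun m z ≠ 0 := by
  intro h
  have := kFun_im_pos hz
  simp [h] at this

theorem add_mul_sub_eq_kFun_sq (m : ℝ) (z : ℂ) : (z + m) * (z - m) = kFun m z ^ 2 := by
  rw [kFun_sq]; ring

theorem add_ne_zero_of_notMem (hz : z ∉ halfLines m) : z + m ≠ 0 := by
  intro h
  have := add_mul_sub_eq_kFun_sq m z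
  rw [h, zero_mul] at this
  exact kFun_ne_zero hz (pow_eq_zero_iff (two_ne_zero) |>.1 this.symm)

theorem sub_ne_zero_of_notMem (hz : z ∉ halfLines m) : z - m ≠ 0 := by
  intro h
  have := add_mul_sub_eq_kFun_sq m z
  rw [h, mul_zero] at this
  exact kFun_ne_zero hz (pow_eq_zero_iff (two_ne_zero) |>.1 this.symm)

theorem isClosed_halfLines (m : ℝ) : IsClosed (halfLines m) :=
  Complex.isometry_ofReal.isClosedEmbedding.isClosedMap _ (isClosed_Iic.union isClosed_Ici)

theorem halfLines_nonempty (m : ℝ) : (halfLines m).Nonempty := ⟨_, m, Or.inr self_mem_Ici, rfl⟩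

end WaveNumber

/-! ### Constant matrices on `L²` and adjoints of the convolution operators -/

section ConstMul

variable {M N : Matrix (Fin 2) (Fin 2) ℂ}

theorem coeFn_constMul (M : Matrix (Fin 2) (Fin 2) ℂ) (f : L2) :
    constMul M f =ᵐ[volume] fun x => matOp M (f x) :=
  ContinuousLinearMap.coeFn_compLpL _ _

theorem constMul_mul (M N : Matrix (Fin 2) (Fin 2) ℂ) (f : L2) :
    constMul M (constMul N f) = constMul (M * N) f := by
  refine Lp.ext ?_
  filter_upwards [coeFn_constMul M (constMul N f), coeFn_constMul N f, coeFn_constMul (M * N) f]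
    with x h1 h2 h3
  rw [h1, h2, h3, matOp, matOp, matOp, map_mul]
  rfl

theorem constMul_one (f : L2) : constMul 1 f = f := by
  refine Lp.ext ?_
  filter_upwards [coeFn_constMul 1 f] with x h1
  rw [h1, matOp, map_one]
  rfl

theorem constMul_add (M N : Matrix (Fin 2) (Fin 2) ℂ) (f : L2) :
    constMul (M + N) f = constMul M f + constMul N f := by
  rw [constMul, matOp, map_add, ContinuousLinearMap.add_compLpL]
  rfl

theorem constMul_smul (a : ℂ) (M : Matrix (Fin 2) (Fin 2) ℂ) (f : L2) :
    constMul (a • M) f = a • constMul M f := by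
  rw [constMul, matOp, map_smul, ContinuousLinearMap.smul_compLpL]
  rfl

theorem constMul_zero (f : L2) : constMul 0 f = 0 := by
  have := constMul_smul 0 0 f
  simpa using this

theorem inner_constMul (M : Matrix (Fin 2) (Fin 2) ℂ) (f g : L2) :
    inner ℂ g (constMul M f) = inner ℂ (constMul M.conjTranspose g) f := by
  rw [L2.inner_def, L2.inner_def]
  refine integral_congr_ae ?_
  filter_upwards [coeFn_constMul M f, coeFn_constMul M.conjTranspose g] with x h1 h2
  rw [h1, h2, matOp, matOp, ← Matrix.star_eq_conjTranspose, map_star,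
    ContinuousLinearMap.star_eq_adjoint, ContinuousLinearMap.adjoint_inner_left]

theorem IsWeakDeriv.constMul (M : Matrix (Fin 2) (Fin 2) ℂ) {f g : L2} (h : IsWeakDeriv f g) :
    IsWeakDeriv (constMul M f) (constMul M g) := by
  have key : ∀ (u : L2) {ψ : ℝ → ℝ}, Continuous ψ → HasCompactSupport ψ →
      ∫ x, ψ x • DiracLine.constMul M u x = matOp M (∫ x, ψ x • u x) := by
    intro u ψ hψ hψc
    rw [← ContinuousLinearMap.integral_comp_comm _ (integrable_test_smul u hψ hψc)]
    refine integral_congr_ae ?_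
    filter_upwards [coeFn_constMul M u] with x hx
    rw [hx, RCLike.real_smul_eq_coe_smul (K := ℂ), RCLike.real_smul_eq_coe_smul (K := ℂ), map_smul]
  intro φ hφ hφc
  rw [key f (hφ.continuous_deriv (by simp)) hφc.deriv, key g hφ.continuous hφc, h φ hφ hφc, map_neg]

theorem IsConvKernel.op_constMul {c : ℝ → ℂ} (hc : IsConvKernel c)
    (M : Matrix (Fin 2) (Fin 2) ℂ) (f : L2) :
    hc.op (constMul M f) = constMul M (hc.op f) := by
  refine Lp.ext ?_
  filter_upwards [hc.coeFn_op (constMul M f), hc.coeFn_op f, coeFn_constMul M (hc.op f)]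
    with x h1 h2 h3
  rw [h1, h3, h2, convFun_congr (coeFn_constMul M f), convFun, convFun,
    ← ContinuousLinearMap.integral_comp_comm _ (hc.integrable_smul (Lp.memLp f) x)]
  simp only [map_smul]

theorem IsConvKernel.op_congr {c c' : ℝ → ℂ} (hc : IsConvKernel c) (hc' : IsConvKernel c')
    (h : c = c') (f : L2) : hc.op f = hc'.op f := by
  subst h; rfl

theorem inner_expOp {k k' : ℂ} (hk : 0 < k.im) (hk' : 0 < k'.im) (h : k' = -(starRingEnd ℂ) k)
    (f g : L2) : inner ℂ g (expOp hk f) = inner ℂ (expOp hk' g) f := by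
  rw [expOp, IsConvKernel.inner_op, expOp]
  congr 1
  refine IsConvKernel.op_congr _ _ ?_ _
  ext t
  simp [expKer, h, ← Complex.exp_conj]

theorem inner_sgnOp {k k' : ℂ} (hk : 0 < k.im) (hk' : 0 < k'.im) (h : k' = -(starRingEnd ℂ) k)
    (f g : L2) : inner ℂ g (sgnOp hk f) = -inner ℂ (sgnOp hk' g) f := by
  have e : (fun t => (starRingEnd ℂ) (sgnKer k (-t))) = fun t => -sgnKer k' t := by
    ext t
    simp [sgnKer, expKer, h, ← Complex.exp_conj, Real.sign_neg]
  have hn : IsConvKernel fun t => -sgnKer k' t := e ▸ (isConvKernel_sgnKer hk).reflect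
  rw [sgnOp, IsConvKernel.inner_op, sgnOp, ← inner_neg_left,
    IsConvKernel.op_congr _ hn e]
  congr 1
  refine Lp.ext ?_
  filter_upwards [hn.coeFn_op g, (isConvKernel_sgnKer hk').coeFn_op g,
    Lp.coeFn_neg ((isConvKernel_sgnKer hk').op g)] with x h1 h2 h3
  rw [h1, h3, Pi.neg_apply, h2, convFun, convFun, ← integral_neg]
  simp only [neg_smul]

end ConstMul

/-! ### The free resolvent and its normality -/

section FreeResolvent

variable {m : ℝ} {z : ℂ}

theorem weakDeriv_eq {f g : L2} (h : IsWeakDeriv f g) (hf : f ∈ H1) : weakDeriv ⟨f, hf⟩ = g :=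
  (isWeakDeriv_weakDeriv ⟨f, hf⟩).unique h

theorem freeDirac_apply (m : ℝ) {f g : L2} (h : IsWeakDeriv f g) :
    ∃ hf : f ∈ (freeDirac m).domain, freeDirac m ⟨f, hf⟩ =
      -Complex.I • constMul pauli1 g + (m : ℂ) • constMul pauli3 f := by
  have hf : f ∈ H1 := ⟨g, h⟩
  refine ⟨hf, ?_⟩
  change -Complex.I • constMul pauli1 (weakDeriv ⟨f, hf⟩) + (m : ℂ) • constMul pauli3 f = _
  rw [weakDeriv_eq h]

/-- The diagonal matrix `diag(ζ, ζ⁻¹)` with `ζ = (z + m) / k(z)`. -/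
def zetaMat (m : ℝ) (z : ℂ) : Matrix (Fin 2) (Fin 2) ℂ :=
  !![(z + m) / kFun m z, 0; 0, (z - m) / kFun m z]

/-- The convolution operator with the Green's function of the free Dirac operator. -/
def freeRes (hz : z ∉ halfLines m) : L2 →L[ℂ] L2 :=
  (Complex.I / 2) • (constMul (zetaMat m z) ∘L expOp (kFun_im_pos hz) +
    constMul pauli1 ∘L sgnOp (kFun_im_pos hz))

theorem freeRes_apply (hz : z ∉ halfLines m) (f : L2) :
    freeRes hz f = (Complex.I / 2) • (constMul (zetaMat m z) (expOp (kFun_im_pos hz) f) +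
      constMul pauli1 (sgnOp (kFun_im_pos hz) f)) := rfl

theorem pauli1_mul_pauli1 : pauli1 * pauli1 = 1 := by
  ext i j; fin_cases i <;> fin_cases j <;> simp [pauli1, Matrix.mul_apply, Fin.sum_univ_two]

/-- This is the coefficient of `e^{ik|t|}` in `(H₀ - z)` applied to the Green's function, up to the
factor `i/2`. `pauli1_mul_zetaMat` is the coefficient of `sgn(t) e^{ik|t|}`, and
`zetaMat_mul_pauli1` its counterpart for the product in the other order. -/
theorem zetaMat_identity (hz : z ∉ halfLines m) :
    (m : ℂ) • (pauli3 * zetaMat m z) - z • zetaMat m z + kFun m z • (pauli1 * pauli1) = 0 := by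
  have hk := kFun_ne_zero hz
  have h2 := kFun_sq m z
  ext i j
  fin_cases i <;> fin_cases j <;>
    simp [pauli1, pauli3, zetaMat] <;> field_simp <;>
    linear_combination h2

theorem pauli3_mul_zetaMat : pauli3 * zetaMat m z = zetaMat m z * pauli3 := by
  ext i j
  fin_cases i <;> fin_cases j <;>
    simp [pauli3, zetaMat, Matrix.mul_apply, Fin.sum_univ_two]

theorem pauli1_mul_zetaMat (hz : z ∉ halfLines m) :
    kFun m z • (pauli1 * zetaMat m z) + (m : ℂ) • (pauli3 * pauli1) - z • pauli1 = 0 := by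
  have hk := kFun_ne_zero hz
  ext i j
  fin_cases i <;> fin_cases j <;>
    simp [pauli1, pauli3, zetaMat] <;> field_simp <;> ring

theorem zetaMat_mul_pauli1 (hz : z ∉ halfLines m) :
    kFun m z • (zetaMat m z * pauli1) + (m : ℂ) • (pauli1 * pauli3) - z • pauli1 = 0 := by
  have hk := kFun_ne_zero hz
  ext i j
  fin_cases i <;> fin_cases j <;>
    simp [pauli1, pauli3, zetaMat] <;> field_simp <;> ring

theorem constMul_sub (M N : Matrix (Fin 2) (Fin 2) ℂ) (f : L2) :
    constMul (M - N) f = constMul M f - constMul N f := by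
  have := constMul_add (M - N) N f
  rw [sub_add_cancel] at this
  rw [this, add_sub_cancel_right]

theorem isResolventAt_freeRes (hz : z ∉ halfLines m) :
    IsResolventAt (freeDirac m) z (freeRes hz) := by
  have hk := kFun_im_pos hz
  set k := kFun m z with hkdef
  have hA : ∀ f, constMul (pauli1 * pauli1) f = f := fun f => by
    rw [pauli1_mul_pauli1, constMul_one]
  have hB : ∀ f, (m : ℂ) • constMul (pauli3 * zetaMat m z) f - z • constMul (zetaMat m z) f +
      k • f = 0 := fun f => by
    have := congrArg (fun M => constMul M f) (zetaMat_identity hz)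
    simpa only [constMul_add, constMul_sub, constMul_smul, constMul_zero, hA] using this
  have hC : ∀ f, k • constMul (pauli1 * zetaMat m z) f + (m : ℂ) • constMul (pauli3 * pauli1) f -
      z • constMul pauli1 f = 0 := fun f => by
    have := congrArg (fun M => constMul M f) (pauli1_mul_zetaMat hz)
    simpa only [constMul_add, constMul_sub, constMul_smul, constMul_zero] using this
  have hD : ∀ f, k • constMul (zetaMat m z * pauli1) f + (m : ℂ) • constMul (pauli1 * pauli3) f -
      z • constMul pauli1 f = 0 := fun f => by
    have := congrArg (fun M => constMul M f) (zetaMat_mul_pauli1 hz)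
    simpa only [constMul_add, constMul_sub, constMul_smul, constMul_zero] using this
  have hI : Complex.I * Complex.I = -1 := Complex.I_mul_I
  constructor
  · intro y
    have hd : IsWeakDeriv (freeRes hz y) ((Complex.I / 2) •
        (constMul (zetaMat m z) ((Complex.I * k) • sgnOp hk y) +
          constMul pauli1 ((2 : ℂ) • y + (Complex.I * k) • expOp hk y))) :=
      (((isWeakDeriv_expOp hk y).constMul _).add ((isWeakDeriv_sgnOp hk y).constMul _)).smul _
    obtain ⟨hf, e⟩ := freeDirac_apply m hd
    refine ⟨hf, ?_⟩
    rw [e, freeRes_apply]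
    simp only [map_add, map_smul, constMul_mul, hA, smul_add, smul_smul]
    have h1 := hB (expOp hk y)
    have h2 := hC (sgnOp hk y)
    -- The identity to be shown is `y = y` plus two vanishing combinations; the remaining `y` is the
    -- delta term, from `-i · (i/2) · 2 = 1`. After this, coefficients are compared.
    have h3 : (Complex.I / 2) • ((m : ℂ) • constMul (pauli3 * zetaMat m z) (expOp hk y) -
        z • constMul (zetaMat m z) (expOp hk y) + k • expOp hk y) + (Complex.I / 2) •
        (k • constMul (pauli1 * zetaMat m z) (sgnOp hk y) +
          (m : ℂ) • constMul (pauli3 * pauli1) (sgnOp hk y) -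
          z • constMul pauli1 (sgnOp hk y)) + y = y := by
      rw [h1, h2]; simp
    rw [← sub_eq_zero] at h3 ⊢
    rw [← h3]
    match_scalars <;>
      first
      | ring1
      | linear_combination (-1 : ℂ) * hI
      | linear_combination (-Complex.I * k / 2) * hI
  · rintro ⟨f, hf⟩
    obtain ⟨g, hg⟩ := id hf
    obtain ⟨hf', e⟩ := freeDirac_apply m hg
    have hc1 : ∀ M f, expOp hk (constMul M f) = constMul M (expOp hk f) :=
      fun M f => (isConvKernel_expKer hk).op_constMul M f
    have hc2 : ∀ M f, sgnOp hk (constMul M f) = constMul M (sgnOp hk f) :=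
      fun M f => (isConvKernel_sgnKer hk).op_constMul M f
    rw [e, freeRes_apply]
    simp only [map_add, map_sub, map_smul, hc1, hc2, expOp_of_isWeakDeriv hk hg,
      sgnOp_of_isWeakDeriv hk hg, constMul_mul, hA, smul_add, smul_smul, smul_sub]
    have h1 := hB (expOp hk f)
    have h2 := hD (sgnOp hk f)
    rw [pauli3_mul_zetaMat] at h1
    have h3 : (Complex.I / 2) • ((m : ℂ) • constMul (zetaMat m z * pauli3) (expOp hk f) -
        z • constMul (zetaMat m z) (expOp hk f) + k • expOp hk f) + (Complex.I / 2) •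
        (k • constMul (zetaMat m z * pauli1) (sgnOp hk f) +
          (m : ℂ) • constMul (pauli1 * pauli3) (sgnOp hk f) -
          z • constMul pauli1 (sgnOp hk f)) + f = f := by
      rw [h1, h2]; simp
    rw [← sub_eq_zero] at h3 ⊢
    rw [← h3]
    match_scalars <;>
      first
      | ring1
      | linear_combination (-1 : ℂ) * hI
      | linear_combination (-Complex.I * k / 2) * hI

theorem conjTranspose_pauli1 : pauli1.conjTranspose = pauli1 := by
  ext i j; fin_cases i <;> fin_cases j <;> simp [pauli1]

theorem conjTranspose_zetaMat (hz : z ∉ halfLines m) :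
    (zetaMat m z).conjTranspose = -zetaMat m ((starRingEnd ℂ) z) := by
  rw [zetaMat, zetaMat, kFun_conj hz]
  ext i j; fin_cases i <;> fin_cases j <;> simp [div_neg]

theorem notMem_conj (hz : z ∉ halfLines m) : (starRingEnd ℂ) z ∉ halfLines m :=
  fun h => hz (conj_mem_halfLines_iff.1 h)

/-- Three signs cancel: conjugation turns `i/2` into `-i/2`, the diagonal matrix into the negative
of the one at the conjugate point, and `sgn` is odd. -/
theorem inner_freeRes (hz : z ∉ halfLines m) (f g : L2) :
    inner ℂ g (freeRes hz f) = inner ℂ (freeRes (notMem_conj hz) g) f := by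
  have hk := kFun_im_pos hz
  have hk' := kFun_im_pos (notMem_conj hz)
  have hc : constMul (zetaMat m z).conjTranspose g =
      -constMul (zetaMat m ((starRingEnd ℂ) z)) g := by
    rw [conjTranspose_zetaMat hz, ← neg_one_smul ℂ, constMul_smul, neg_one_smul]
  rw [freeRes_apply, freeRes_apply, inner_smul_right, inner_smul_left, inner_add_right,
    inner_add_left, inner_constMul, inner_constMul, conjTranspose_pauli1,
    inner_expOp hk hk' (kFun_conj hz), inner_sgnOp hk hk' (kFun_conj hz), hc]
  have e1 : expOp hk' (constMul (zetaMat m ((starRingEnd ℂ) z)) g) =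
      constMul (zetaMat m ((starRingEnd ℂ) z)) (expOp hk' g) :=
    (isConvKernel_expKer hk').op_constMul _ g
  have e2 : sgnOp hk' (constMul pauli1 g) = constMul pauli1 (sgnOp hk' g) :=
    (isConvKernel_sgnKer hk').op_constMul _ g
  rw [map_neg, e1, e2, inner_neg_left]
  simp [Complex.conj_ofNat]
  ring

theorem adjoint_freeRes (hz : z ∉ halfLines m) :
    ContinuousLinearMap.adjoint (freeRes hz) = freeRes (notMem_conj hz) := by
  refine ((ContinuousLinearMap.eq_adjoint_iff _ _).2 fun g f => ?_).symm
  exact (inner_freeRes hz f g).symm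

/-- The adjoint is the resolvent of the same operator at the conjugate point. The resolvent identity
in both orders, divided by `z` minus its conjugate, shows that the two commute; for real `z` they
coincide. -/
theorem isStarNormal_freeRes (hz : z ∉ halfLines m) : IsStarNormal (freeRes hz) := by
  refine ⟨?_⟩
  rw [ContinuousLinearMap.star_eq_adjoint, adjoint_freeRes hz]
  have h1 := isResolventAt_freeRes hz
  have h2 := isResolventAt_freeRes (notMem_conj hz)
  by_cases h : (starRingEnd ℂ) z = z
  · have aux : ∀ w (hw : w ∉ halfLines m), w = z → freeRes hw = freeRes hz := by
      rintro w hw rfl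
      rfl
    rw [aux _ _ h]
  · have e1 := h1.sub_eq h2
    have e2 := h2.sub_eq h1
    have e3 : (z - (starRingEnd ℂ) z) • (freeRes (notMem_conj hz) ∘L freeRes hz) =
        (z - (starRingEnd ℂ) z) • (freeRes hz ∘L freeRes (notMem_conj hz)) := by
      rw [← e1, ← neg_sub ((starRingEnd ℂ) z), neg_smul, ← e2, neg_sub]
    exact smul_right_injective _ (sub_ne_zero.2 (Ne.symm h)) e3

end FreeResolvent

/-! ### Pointwise bounds on the Green's function -/

section GreenBound

variable {m : ℝ} {z : ℂ}

theorem eta_nonneg (s : ℝ) : 0 ≤ eta s := Real.sqrt_nonneg _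

theorem eta_sq {s : ℝ} (hs : 0 ≤ s) : eta s ^ 2 = 1 / 2 + 1 / 4 * (s + s⁻¹) :=
  Real.sq_sqrt (by positivity)

theorem norm_kFun_sq (m : ℝ) (z : ℂ) : ‖kFun m z‖ ^ 2 = ‖z + m‖ * ‖z - m‖ := by
  rw [← norm_pow, ← add_mul_sub_eq_kFun_sq, norm_mul]

/-- This is where `Φ` enters: `|k|² = |z + m| |z - m|`, so `|ζ|² = |Φ|`. -/
theorem norm_add_div_kFun_sq (hz : z ∉ halfLines m) :
    ‖(z + m) / kFun m z‖ ^ 2 = ‖phi m z‖ := by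
  have h1 := norm_pos_iff.2 (add_ne_zero_of_notMem hz)
  have h2 := norm_pos_iff.2 (sub_ne_zero_of_notMem hz)
  rw [norm_div, div_pow, norm_kFun_sq, phi, norm_div]
  field_simp

theorem norm_sub_div_kFun_sq (hz : z ∉ halfLines m) :
    ‖(z - m) / kFun m z‖ ^ 2 = ‖phi m z‖⁻¹ := by
  have h1 := norm_pos_iff.2 (add_ne_zero_of_notMem hz)
  have h2 := norm_pos_iff.2 (sub_ne_zero_of_notMem hz)
  rw [norm_div, div_pow, norm_kFun_sq, phi, norm_div]
  field_simp

theorem norm_add_sq_le_mul (a b u v : ℂ) :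
    ‖a * u + b * v‖ ^ 2 ≤ (‖a‖ ^ 2 + ‖b‖ ^ 2) * (‖u‖ ^ 2 + ‖v‖ ^ 2) := by
  have h := norm_add_le (a * u) (b * v)
  rw [norm_mul, norm_mul] at h
  calc ‖a * u + b * v‖ ^ 2 ≤ (‖a‖ * ‖u‖ + ‖b‖ * ‖v‖) ^ 2 := by gcongr
    _ ≤ _ := by nlinarith [sq_nonneg (‖a‖ * ‖v‖ - ‖b‖ * ‖u‖)]

/-- The pointwise bound on the Green's function of the free Dirac operator. -/
theorem norm_green_le (hz : z ∉ halfLines m) {e s : ℂ} (hs : ‖s‖ ≤ ‖e‖) (v : Spinor) :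
    ‖(Complex.I / 2) • (e • matOp (zetaMat m z) v + s • matOp pauli1 v)‖ ≤
      eta ‖phi m z‖ * (‖e‖ * ‖v‖) := by
  have hη := eta_nonneg ‖phi m z‖
  rw [← sq_le_sq₀ (norm_nonneg _) (by positivity), norm_smul, mul_pow, mul_pow,
    eta_sq (norm_nonneg _), ← norm_add_div_kFun_sq hz, mul_pow]
  have h2 := norm_sub_div_kFun_sq hz
  rw [← norm_add_div_kFun_sq hz] at h2
  rw [← h2, EuclideanSpace.norm_sq_eq, EuclideanSpace.norm_sq_eq, Fin.sum_univ_two,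
    Fin.sum_univ_two]
  set ζ := (z + m) / kFun m z with hζ
  set ξ := (z - m) / kFun m z with hξ
  have e0 : (e • matOp (zetaMat m z) v + s • matOp pauli1 v) 0 = (e * ζ) * v 0 + s * v 1 := by
    simp [matOp, zetaMat, pauli1, Matrix.mulVec, dotProduct, Fin.sum_univ_two, hζ]
    ring
  have e1 : (e • matOp (zetaMat m z) v + s • matOp pauli1 v) 1 = s * v 0 + (e * ξ) * v 1 := by
    simp [matOp, zetaMat, pauli1, Matrix.mulVec, dotProduct, Fin.sum_univ_two, hξ]
    ring
  rw [e0, e1]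
  -- Cauchy-Schwarz in each row bounds the operator norm by the Hilbert-Schmidt norm. With `|s| ≤
  -- |e|` its square is at most `|e|² (|ζ|² + |ζ|⁻² + 2) / 4 = |e|² η²`.
  have b0 := norm_add_sq_le_mul (e * ζ) s (v 0) (v 1)
  have b1 := norm_add_sq_le_mul s (e * ξ) (v 0) (v 1)
  rw [norm_mul, mul_pow] at b0 b1
  have hs2 : ‖s‖ ^ 2 ≤ ‖e‖ ^ 2 := by gcongr
  have hV : 0 ≤ ‖v 0‖ ^ 2 + ‖v 1‖ ^ 2 := by positivity
  have hs3 := mul_le_mul_of_nonneg_right hs2 hV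
  have hI : ‖Complex.I / 2‖ ^ 2 = 1 / 4 := by simp; norm_num
  rw [hI]
  linarith

theorem norm_freeRes_apply_le (hz : z ∉ halfLines m) (f : L2) :
    ∀ᵐ x, ‖freeRes hz f x‖ ≤
      eta ‖phi m z‖ * ∫ y, ‖expKer (kFun m z) (x - y)‖ * ‖f y‖ := by
  have hk := kFun_im_pos hz
  have he := isConvKernel_expKer hk
  have hs := isConvKernel_sgnKer hk
  set k := kFun m z
  have h0 : freeRes hz f = (Complex.I / 2) • (constMul (zetaMat m z) (expOp hk f) +
      constMul pauli1 (sgnOp hk f)) := rfl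
  filter_upwards [Lp.coeFn_smul (Complex.I / 2) (constMul (zetaMat m z) (expOp hk f) +
      constMul pauli1 (sgnOp hk f)),
    Lp.coeFn_add (constMul (zetaMat m z) (expOp hk f)) (constMul pauli1 (sgnOp hk f)),
    coeFn_constMul (zetaMat m z) (expOp hk f), coeFn_constMul pauli1 (sgnOp hk f),
    he.coeFn_op f, hs.coeFn_op f] with x h1 h2 h3 h4 h5 h6
  have i1 := he.integrable_smul (Lp.memLp f) x
  have i2 := hs.integrable_smul (Lp.memLp f) x
  have e1 : freeRes hz f x = ∫ y, (Complex.I / 2) • (expKer k (x - y) • matOp (zetaMat m z) (f y) +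
      sgnKer k (x - y) • matOp pauli1 (f y)) := by
    rw [h0, h1, Pi.smul_apply, h2, Pi.add_apply, h3, h4, expOp, h5, sgnOp, h6, convFun, convFun,
      ← ContinuousLinearMap.integral_comp_comm _ i1, ← ContinuousLinearMap.integral_comp_comm _ i2,
      ← integral_add (ContinuousLinearMap.integrable_comp _ i1)
        (ContinuousLinearMap.integrable_comp _ i2), ← integral_smul]
    simp only [map_smul]
  rw [e1, ← integral_const_mul]
  refine (norm_integral_le_integral_norm _).trans ?_
  refine integral_mono_of_nonneg (ae_of_all _ fun y => norm_nonneg _) ?_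
    (ae_of_all _ fun y => norm_green_le hz (norm_sgnKer_le k _) (f y))
  have := i1.norm
  simp only [norm_smul] at this
  exact this.const_mul _

theorem integral_norm_expKer_sq {k : ℂ} (hk : 0 < k.im) (x : ℝ) :
    ∫ y, ‖expKer k (x - y)‖ ^ 2 = 1 / k.im := by
  rw [integral_sub_left_eq_self (fun t => ‖expKer k t‖ ^ 2)]
  have : ∀ t, ‖expKer k t‖ ^ 2 = Real.exp (-(2 * k.im) * |t|) := fun t => by
    rw [norm_expKer, ← Real.exp_nat_mul]
    congr 1
    push_cast
    ring
  simp only [this]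
  rw [integral_exp_neg_mul_abs (by positivity)]
  field_simp

theorem norm_freeRes_apply_le_norm (hz : z ∉ halfLines m) (f : L2) :
    ∀ᵐ x, ‖freeRes hz f x‖ ≤ eta ‖phi m z‖ * (√(1 / (kFun m z).im) * ‖f‖) := by
  filter_upwards [norm_freeRes_apply_le hz f] with x hx
  refine hx.trans ?_
  have hη := eta_nonneg ‖phi m z‖
  gcongr
  have := integral_norm_mul_norm_le_sqrt ((isConvKernel_expKer (kFun_im_pos hz)).memLp_comp x)
    (Lp.memLp f)
  rwa [integral_norm_expKer_sq (kFun_im_pos hz), ← norm_eq_sqrt_integral] at this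

end GreenBound

/-! ### Bounds for `A R₀(z)`, `R₀(z) B` and `A R₀(z) B` -/

section Factorization

variable {m : ℝ} {z : ℂ} {ν : ℝ → ℝ} {W : ℝ → Spinor →L[ℂ] Spinor}

theorem memLp_of_le_sqrt (hν : Integrable ν) (hν0 : ∀ x, 0 ≤ ν x) {F : ℝ → Spinor}
    (hF : AEStronglyMeasurable F) {C : ℝ} (h : ∀ᵐ x, ‖F x‖ ≤ C * √(ν x)) :
    MemLp F 2 := by
  rw [memLp_two_iff_integrable_sq_norm hF]
  refine (hν.const_mul (C ^ 2)).mono' (hF.norm.pow 2) ?_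
  filter_upwards [h] with x hx
  rw [Real.norm_of_nonneg (by positivity), ← Real.sq_sqrt (hν0 x), ← mul_pow]
  gcongr

theorem norm_le_of_le_sqrt (hν : Integrable ν) (hν0 : ∀ x, 0 ≤ ν x) {F : L2} {C : ℝ}
    (hC : 0 ≤ C) (h : ∀ᵐ x, ‖F x‖ ≤ C * √(ν x)) : ‖F‖ ≤ C * √(∫ x, ν x) := by
  rw [norm_eq_sqrt_integral]
  refine (Real.sqrt_le_left (by positivity)).2 ?_
  rw [mul_pow, Real.sq_sqrt (integral_nonneg hν0), ← integral_const_mul]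
  refine integral_mono_ae (Lp.memLp F).norm.integrable_sq (hν.const_mul _) ?_
  filter_upwards [h] with x hx
  rw [← Real.sq_sqrt (hν0 x), ← mul_pow]
  gcongr

/-- The bounded operator `W R₀(z)`, for a multiplication operator `W` with `‖W‖² ∈ L¹`. -/
theorem exists_mulOp_freeRes (hz : z ∉ halfLines m) (hν : Integrable ν) (hν0 : ∀ x, 0 ≤ ν x)
    (hW : AEStronglyMeasurable W) (hWν : ∀ x, ‖W x‖ ≤ √(ν x)) :
    ∃ X : L2 →L[ℂ] L2, (∀ f, ∃ h : freeRes hz f ∈ (mulOp W).domain, mulOp W ⟨_, h⟩ = X f) ∧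
      ‖X‖ ≤ eta ‖phi m z‖ * √(1 / (kFun m z).im) * √(∫ x, ν x) := by
  have hη := eta_nonneg ‖phi m z‖
  have hb : ∀ f, ∀ᵐ x, ‖W x (freeRes hz f x)‖ ≤
      (eta ‖phi m z‖ * √(1 / (kFun m z).im) * ‖f‖) * √(ν x) := fun f => by
    filter_upwards [norm_freeRes_apply_le_norm hz f] with x hx
    calc ‖W x (freeRes hz f x)‖ ≤ ‖W x‖ * ‖freeRes hz f x‖ := (W x).le_opNorm _
      _ ≤ √(ν x) * (eta ‖phi m z‖ * (√(1 / (kFun m z).im) * ‖f‖)) := by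
        gcongr
        exact hWν x
      _ = _ := by ring
  have hm : ∀ f, freeRes hz f ∈ (mulOp W).domain := fun f =>
    memLp_of_le_sqrt hν hν0 (aestronglyMeasurable_apply hW (Lp.aestronglyMeasurable _)) (hb f)
  have hb' : ∀ f, ‖mulOp W ⟨_, hm f⟩‖ ≤
      eta ‖phi m z‖ * √(1 / (kFun m z).im) * √(∫ x, ν x) * ‖f‖ := fun f => by
    refine (norm_le_of_le_sqrt hν hν0 (by positivity) ?_).trans_eq (mul_right_comm _ _ _)
    filter_upwards [hb f, coeFn_mulOp ⟨_, hm f⟩] with x h1 h2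
    rwa [h2]
  let X : L2 →L[ℂ] L2 := LinearMap.mkContinuous
    ((mulOp W).toFun ∘ₗ (freeRes hz : L2 →ₗ[ℂ] L2).codRestrict (mulOp W).domain hm) _ hb'
  exact ⟨X, fun f => ⟨hm f, rfl⟩, LinearMap.mkContinuous_norm_le _ (by positivity) _⟩

theorem norm_phi_conj (m : ℝ) (z : ℂ) : ‖phi m ((starRingEnd ℂ) z)‖ = ‖phi m z‖ := by
  rw [← Complex.norm_conj (phi m z)]
  congr 1
  simp [phi]

/-- The bounded closure of `R₀(z) W`, for a multiplication operator `W` with `‖W‖² ∈ L¹`. -/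
theorem exists_freeRes_mulOp (hz : z ∉ halfLines m) (hν : Integrable ν) (hν0 : ∀ x, 0 ≤ ν x)
    (hW : AEStronglyMeasurable W) (hWν : ∀ x, ‖W x‖ ≤ √(ν x)) :
    ∃ Y : L2 →L[ℂ] L2, (∀ u : (mulOp W).domain, Y u = freeRes hz (mulOp W u)) ∧
      ‖Y‖ ≤ eta ‖phi m z‖ * √(1 / (kFun m z).im) * √(∫ x, ν x) := by
  have hW' : AEStronglyMeasurable fun x => ContinuousLinearMap.adjoint (W x) :=
    (ContinuousLinearMap.adjoint (𝕜 := ℂ) (E := Spinor) (F := Spinor)).continuous.comp_aestronglyMeasurable hW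
  -- The operator sought is the adjoint of `W* R₀` at the conjugate point, where `|Φ|` and `Im k`
  -- have the same values.
  obtain ⟨X, hX, hXn⟩ := exists_mulOp_freeRes (notMem_conj hz) hν hν0 hW'
    (fun x => by rw [LinearIsometryEquiv.norm_map]; exact hWν x)
  rw [norm_phi_conj, kFun_conj hz, Complex.neg_im, Complex.conj_im, neg_neg] at hXn
  refine ⟨ContinuousLinearMap.adjoint X, fun u => ?_, by rwa [LinearIsometryEquiv.norm_map]⟩
  refine ext_inner_left ℂ fun g => ?_
  rw [ContinuousLinearMap.adjoint_inner_right, inner_freeRes hz, L2.inner_def, L2.inner_def]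
  refine integral_congr_ae ?_
  obtain ⟨h, e⟩ := hX g
  filter_upwards [coeFn_mulOp ⟨_, h⟩, coeFn_mulOp u] with x h1 h2
  rw [← e, h1, h2, ContinuousLinearMap.adjoint_inner_left]

/-- The bounded closure of `A R₀(z) B`, for multiplication operators `A`, `B` with
`‖A‖², ‖B‖² ∈ L¹`. -/
theorem exists_mulOp_freeRes_mulOp (hz : z ∉ halfLines m) (hν : Integrable ν)
    (hν0 : ∀ x, 0 ≤ ν x) (hW : AEStronglyMeasurable W) (hWν : ∀ x, ‖W x‖ ≤ √(ν x))
    {W' : ℝ → Spinor →L[ℂ] Spinor} (hWν' : ∀ x, ‖W' x‖ ≤ √(ν x))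
    {X : L2 →L[ℂ] L2} (hX : ∀ f, ∃ h : freeRes hz f ∈ (mulOp W').domain, mulOp W' ⟨_, h⟩ = X f) :
    ∃ Q : L2 →L[ℂ] L2, (∀ u : (mulOp W).domain, Q u = X (mulOp W u)) ∧
      ‖Q‖ ≤ eta ‖phi m z‖ * ∫ x, ν x := by
  have hη := eta_nonneg ‖phi m z‖
  have hI : 0 ≤ ∫ x, ν x := integral_nonneg hν0
  have hb : ∀ u : (mulOp W).domain, ‖X (mulOp W u)‖ ≤ eta ‖phi m z‖ * (∫ x, ν x) * ‖(u : L2)‖ := by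
    intro u
    have hsq : MemLp (fun y => √(ν y)) 2 := by
      have hm : AEStronglyMeasurable fun y => √(ν y) :=
        Real.continuous_sqrt.comp_aestronglyMeasurable hν.1
      rw [memLp_two_iff_integrable_sq_norm hm]
      refine hν.congr (ae_of_all _ fun y => ?_)
      simp only [Real.norm_of_nonneg (Real.sqrt_nonneg _), Real.sq_sqrt (hν0 y)]
    have h1 : ∀ x, ∫ y, ‖expKer (kFun m z) (x - y)‖ * ‖mulOp W u y‖ ≤ √(∫ x, ν x) * ‖(u : L2)‖ := by
      intro x
      have h2 := integral_norm_mul_norm_le_sqrt hsq (Lp.memLp (u : L2))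
      rw [← norm_eq_sqrt_integral] at h2
      simp only [Real.norm_of_nonneg (Real.sqrt_nonneg _), Real.sq_sqrt (hν0 _)] at h2
      refine le_trans (integral_mono_of_nonneg (ae_of_all _ fun y => by positivity) ?_ ?_) h2
      · have := integrable_norm_mul_norm hsq (Lp.memLp (u : L2))
        simpa only [Real.norm_of_nonneg (Real.sqrt_nonneg _)] using this
      · filter_upwards [coeFn_mulOp u] with y hy
        rw [hy]
        -- Here the decay of the kernel is given up, which is why `‖Q(z)‖` has a bound without `Im
        -- k`: the factors `√ν` on both sides already supply integrability.
        have h3 : ‖expKer (kFun m z) (x - y)‖ ≤ 1 := by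
          rw [norm_expKer, Real.exp_le_one_iff, neg_mul, neg_nonpos]
          have := kFun_im_pos hz
          positivity
        calc ‖expKer (kFun m z) (x - y)‖ * ‖W y ((u : L2) y)‖ ≤ 1 * (‖W y‖ * ‖(u : L2) y‖) := by
              gcongr
              exact (W y).le_opNorm _
          _ ≤ √(ν y) * ‖(u : L2) y‖ := by
              rw [one_mul]
              gcongr
              exact hWν y
    obtain ⟨h, e⟩ := hX (mulOp W u)
    refine (norm_le_of_le_sqrt hν hν0 (C := eta ‖phi m z‖ * (√(∫ x, ν x) * ‖(u : L2)‖))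
      (by positivity) ?_).trans_eq ?_
    · filter_upwards [norm_freeRes_apply_le hz (mulOp W u), coeFn_mulOp ⟨_, h⟩] with x h2 h3
      rw [← e, h3]
      calc _ ≤ ‖W' x‖ * ‖freeRes hz (mulOp W u) x‖ := (W' x).le_opNorm _
        _ ≤ √(ν x) * (eta ‖phi m z‖ * (√(∫ x, ν x) * ‖(u : L2)‖)) := by
          gcongr
          · exact hWν' x
          · exact h2.trans (by gcongr; exact h1 x)
        _ = _ := mul_comm _ _
    · linear_combination (eta ‖phi m z‖ * ‖(u : L2)‖) * Real.mul_self_sqrt hI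
  have hd : Dense ((opComp (ofCLM X) (mulOp W)).domain : Set L2) := by
    convert dense_mulOp_domain hW using 1
    ext u
    exact mem_domain_opComp_ofCLM
  obtain ⟨Q, hQ, hQn⟩ := exists_isBoundedClosure hd (C := eta ‖phi m z‖ * ∫ x, ν x)
    (by positivity) (fun u => hb ⟨u, mem_domain_opComp_ofCLM.1 u.2⟩)
  exact ⟨Q, fun u => hQ.2 ⟨u, mem_domain_opComp_ofCLM.2 u.2⟩, hQn⟩

end Factorization

/-! ### The spectrum of the free operator, by Weyl sequences -/

section WeylSequence

variable {m : ℝ}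

theorem memLp_of_compact {u : ℝ → Spinor} (hu : ContDiff ℝ ∞ u) (hc : HasCompactSupport u) :
    MemLp u 2 := hu.continuous.memLp_of_hasCompactSupport hc

theorem memLp_deriv_of_compact {u : ℝ → Spinor} (hu : ContDiff ℝ ∞ u) (hc : HasCompactSupport u) :
    MemLp (deriv u) 2 := (hu.continuous_deriv (by simp)).memLp_of_hasCompactSupport hc.deriv

/-- The classical derivative of a test function is its weak derivative. -/
theorem isWeakDeriv_toLp {u : ℝ → Spinor} (hu : ContDiff ℝ ∞ u) (hc : HasCompactSupport u) :
    IsWeakDeriv ((memLp_of_compact hu hc).toLp u) ((memLp_deriv_of_compact hu hc).toLp _) := by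
  intro φ hφ hφc
  have e1 : ∫ x, deriv φ x • (memLp_of_compact hu hc).toLp u x = ∫ x, deriv φ x • u x := by
    refine integral_congr_ae ?_
    filter_upwards [(memLp_of_compact hu hc).coeFn_toLp] with x hx
    rw [hx]
  have e2 : ∫ x, φ x • (memLp_deriv_of_compact hu hc).toLp _ x = ∫ x, φ x • deriv u x := by
    refine integral_congr_ae ?_
    filter_upwards [(memLp_deriv_of_compact hu hc).coeFn_toLp] with x hx
    rw [hx]
  have hφ' := hφ.continuous_deriv (n := ∞) (by simp)
  have hu' := hu.continuous_deriv (n := ∞) (by simp)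
  have i1 : Integrable fun x => deriv φ x • u x :=
    (hφ'.smul hu.continuous).integrable_of_hasCompactSupport hφc.deriv.smul_right
  have i2 : Integrable fun x => φ x • deriv u x :=
    (hφ.continuous.smul hu').integrable_of_hasCompactSupport hφc.smul_right
  have i3 : Integrable fun x => φ x • u x :=
    (hφ.continuous.smul hu.continuous).integrable_of_hasCompactSupport hφc.smul_right
  have h := integral_eq_zero_of_hasDerivAt_of_integrable
    (fun x => (hφ.differentiable (by simp) x).hasDerivAt.fun_smul
      (hu.differentiable (by simp) x).hasDerivAt) (i2.add i1) i3
  rw [integral_add i2 i1] at h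
  rw [e1, e2, eq_neg_iff_add_eq_zero, add_comm, h]

/-- The determinant of `p σ₁ + m σ₃ - l` is `l² - m² - p²`. -/
theorem exists_spinor_eigenvector {l p : ℝ} (hp : p ^ 2 = l ^ 2 - m ^ 2) :
    ∃ v : Spinor, v ≠ 0 ∧
      (p : ℂ) • matOp pauli1 v + (m : ℂ) • matOp pauli3 v - (l : ℂ) • v = 0 := by
  have hdet : (((p : ℂ) • pauli1 + (m : ℂ) • pauli3 - (l : ℂ) • 1)).det = 0 := by
    have : (p : ℂ) ^ 2 = l ^ 2 - m ^ 2 := by exact_mod_cast hp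
    rw [Matrix.det_fin_two]
    simp [pauli1, pauli3]
    linear_combination -this
  obtain ⟨w, hw, h⟩ := Matrix.exists_mulVec_eq_zero_iff.2 hdet
  refine ⟨WithLp.toLp 2 w, fun h0 => hw ?_, ?_⟩
  · simpa using h0
  · have h1 : matOp ((p : ℂ) • pauli1 + (m : ℂ) • pauli3 - (l : ℂ) • 1) (WithLp.toLp 2 w) = 0 := by
      rw [matOp, Matrix.toEuclideanCLM_toLp, h]
      rfl
    rw [matOp, map_sub, map_add, map_smul, map_smul, map_smul, map_one] at h1
    exact h1

/-- The function `ψ(x) exp(i p x) v`. -/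
def wavePacket (ψ : ℝ → ℝ) (p : ℝ) (v : Spinor) (x : ℝ) : Spinor :=
  ((ψ x : ℂ) * Complex.exp (Complex.I * p * x)) • v

theorem norm_wavePacket (ψ : ℝ → ℝ) (p : ℝ) (v : Spinor) (x : ℝ) :
    ‖wavePacket ψ p v x‖ ^ 2 = ψ x ^ 2 * ‖v‖ ^ 2 := by
  rw [wavePacket, norm_smul, norm_mul, Complex.norm_real, Complex.norm_exp]
  simp [mul_pow]

theorem contDiff_wavePacket {ψ : ℝ → ℝ} (hψ : ContDiff ℝ ∞ ψ) (p : ℝ) (v : Spinor) :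
    ContDiff ℝ ∞ (wavePacket ψ p v) := by
  have h1 : ContDiff ℝ ∞ fun x => (ψ x : ℂ) := Complex.ofRealCLM.contDiff.comp hψ
  have h2 : ContDiff ℝ ∞ fun x : ℝ => Complex.exp (Complex.I * p * x) :=
    ContDiff.cexp (contDiff_const.mul Complex.ofRealCLM.contDiff)
  exact (h1.mul h2).smul contDiff_const

theorem hasCompactSupport_wavePacket {ψ : ℝ → ℝ} (hψ : HasCompactSupport ψ) (p : ℝ)
    (v : Spinor) : HasCompactSupport (wavePacket ψ p v) := by
  refine hψ.mono fun x hx => ?_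
  contrapose! hx
  simp only [Function.mem_support, not_not] at hx ⊢
  simp [wavePacket, hx]

theorem deriv_wavePacket {ψ : ℝ → ℝ} (hψ : ContDiff ℝ ∞ ψ) (p : ℝ) (v : Spinor) (x : ℝ) :
    deriv (wavePacket ψ p v) x =
      wavePacket (deriv ψ) p v x + (Complex.I * p) • wavePacket ψ p v x := by
  have h1 : HasDerivAt (fun x : ℝ => ((ψ x : ℝ) : ℂ)) ((deriv ψ x : ℝ) : ℂ) x :=
    (hψ.differentiable (by simp) x).hasDerivAt.ofReal_comp
  have h2 : HasDerivAt (fun x : ℝ => Complex.exp (Complex.I * p * x))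
      (Complex.exp (Complex.I * p * x) * (Complex.I * p * 1)) x := by
    refine HasDerivAt.cexp (HasDerivAt.const_mul _ ?_)
    simpa using (hasDerivAt_id x).ofReal_comp
  have h3 := ((h1.fun_mul h2).smul_const v).deriv
  unfold wavePacket
  rw [h3]
  module

/-- As `v` solves the eigenvalue equation at momentum `p`, `H₀ - l` sends `ψ e^{ipx} v` to `-i ψ'
e^{ipx} σ₁ v`. A bounded inverse thus controls `‖ψ‖` by `‖ψ'‖`. -/
theorem wavePacket_bound {l p : ℝ} {v : Spinor}
    (hv : (p : ℂ) • matOp pauli1 v + (m : ℂ) • matOp pauli3 v - (l : ℂ) • v = 0)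
    {R : L2 →L[ℂ] L2} (hR : IsResolventAt (freeDirac m) l R) {ψ : ℝ → ℝ} (hψ : ContDiff ℝ ∞ ψ)
    (hψc : HasCompactSupport ψ) :
    (∫ x, ψ x ^ 2) * ‖v‖ ^ 2 ≤ ‖R‖ ^ 2 * ((∫ x, deriv ψ x ^ 2) * ‖matOp pauli1 v‖ ^ 2) := by
  have hu := contDiff_wavePacket hψ p v
  have hc := hasCompactSupport_wavePacket hψc p v
  have hψ' : ContDiff ℝ ∞ (deriv ψ) := (contDiff_infty_iff_deriv.1 hψ).2
  have hw := memLp_of_compact (contDiff_wavePacket hψ' p (matOp pauli1 v))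
    (hasCompactSupport_wavePacket hψc.deriv p (matOp pauli1 v))
  obtain ⟨hf, e⟩ := freeDirac_apply m (isWeakDeriv_toLp hu hc)
  set f := (memLp_of_compact hu hc).toLp _ with hfdef
  have key : freeDirac m ⟨f, hf⟩ - (l : ℂ) • f = -Complex.I • hw.toLp _ := by
    rw [e]
    refine Lp.ext ?_
    set g := (memLp_deriv_of_compact hu hc).toLp _ with hgdef
    filter_upwards [Lp.coeFn_sub (-Complex.I • constMul pauli1 g + (m : ℂ) • constMul pauli3 f)
        ((l : ℂ) • f), Lp.coeFn_add (-Complex.I • constMul pauli1 g) ((m : ℂ) • constMul pauli3 f),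
      Lp.coeFn_smul (-Complex.I) (constMul pauli1 g), Lp.coeFn_smul (m : ℂ) (constMul pauli3 f),
      Lp.coeFn_smul (l : ℂ) f, coeFn_constMul pauli1 g, coeFn_constMul pauli3 f,
      (memLp_of_compact hu hc).coeFn_toLp, (memLp_deriv_of_compact hu hc).coeFn_toLp,
      Lp.coeFn_smul (-Complex.I) (hw.toLp _), hw.coeFn_toLp]
      with x h1 h2 h3 h4 h5 h6 h7 h8 h9 h10 h11
    rw [h1, Pi.sub_apply, h2, Pi.add_apply, h3, h4, h5, Pi.smul_apply, Pi.smul_apply,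
      Pi.smul_apply, h6, h7, h8, h9, h10, Pi.smul_apply, h11, deriv_wavePacket hψ]
    unfold wavePacket
    simp only [map_add, map_smul]
    have h12 := congrArg
      (fun w => ((ψ x : ℂ) * Complex.exp (Complex.I * p * x)) • w) hv
    simp only [smul_zero] at h12
    rw [← sub_eq_zero, ← h12]
    match_scalars <;>
      first
      | ring1
      | linear_combination
          (-(p : ℂ) * (ψ x : ℂ) * Complex.exp (Complex.I * p * x)) * Complex.I_mul_I
  have h1 := hR.2 ⟨f, hf⟩
  have h2 : ‖f‖ ≤ ‖R‖ * ‖hw.toLp _‖ := by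
    calc ‖f‖ = ‖R (freeDirac m ⟨f, hf⟩ - (l : ℂ) • f)‖ := by rw [h1]
      _ ≤ ‖R‖ * ‖freeDirac m ⟨f, hf⟩ - (l : ℂ) • f‖ := R.le_opNorm _
      _ = ‖R‖ * ‖hw.toLp _‖ := by rw [key, norm_smul]; simp
  have h3 : ‖f‖ ^ 2 ≤ ‖R‖ ^ 2 * ‖hw.toLp _‖ ^ 2 := by
    rw [← mul_pow]
    gcongr
  rw [norm_sq_eq_integral, norm_sq_eq_integral] at h3
  have e1 : ∫ x, ‖f x‖ ^ 2 = (∫ x, ψ x ^ 2) * ‖v‖ ^ 2 := by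
    rw [← integral_mul_const]
    refine integral_congr_ae ?_
    filter_upwards [(memLp_of_compact hu hc).coeFn_toLp] with x hx
    rw [hx, norm_wavePacket]
  have e2 : ∫ x, ‖hw.toLp _ x‖ ^ 2 = (∫ x, deriv ψ x ^ 2) * ‖matOp pauli1 v‖ ^ 2 := by
    rw [← integral_mul_const]
    refine integral_congr_ae ?_
    filter_upwards [hw.coeFn_toLp] with x hx
    rw [hx, norm_wavePacket]
  rwa [e1, e2] at h3

/-- Dilating a bump by `n` multiplies `∫ ψ²` by `n` and divides `∫ ψ'²` by `n`, so the bound in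
`wavePacket_bound` fails for large `n`. -/
theorem notMem_resolventSet_of_mem_halfLines {z : ℂ} (hm : 0 ≤ m) (hz : z ∈ halfLines m) :
    z ∉ resolventSet (freeDirac m) := by
  obtain ⟨l, hl, rfl⟩ := hz
  rintro ⟨R, hR⟩
  have hl2 : 0 ≤ l ^ 2 - m ^ 2 := by
    rcases hl with hl | hl
    · have : l ≤ -m := hl
      nlinarith
    · have : m ≤ l := hl
      nlinarith
  obtain ⟨v, hv0, hv⟩ := exists_spinor_eigenvector (m := m) (l := l) (Real.sq_sqrt hl2)
  let χ : ContDiffBump (0 : ℝ) := ⟨1, 2, by norm_num, by norm_num⟩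
  have hχ : ContDiff ℝ ∞ χ := χ.contDiff
  have hχc : HasCompactSupport χ := χ.hasCompactSupport
  have hb : ∀ n : ℕ, 0 < n → (n : ℝ) ^ 2 * ((∫ x, χ x ^ 2) * ‖v‖ ^ 2) ≤
      ‖R‖ ^ 2 * ((∫ x, deriv χ x ^ 2) * ‖matOp pauli1 v‖ ^ 2) := by
    intro n hn
    have hn' : (0 : ℝ) < n := by exact_mod_cast hn
    have hψ : ContDiff ℝ ∞ fun x : ℝ => χ (x / n) := hχ.comp (contDiff_id.div_const _)
    have hψc : HasCompactSupport fun x : ℝ => χ (x / n) :=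
      hχc.comp_homeomorph (Homeomorph.mulRight₀ (n : ℝ)⁻¹ (inv_ne_zero hn'.ne'))
    have hd : ∀ x : ℝ, deriv (fun x : ℝ => χ (x / n)) x = deriv χ (x / n) / n := fun x => by
      have h1 : HasDerivAt χ (deriv χ (x / n)) (x / n) :=
        (hχ.differentiable (by simp) _).hasDerivAt
      have h2 := h1.comp x ((hasDerivAt_id x).div_const (n : ℝ))
      rw [HasDerivAt.deriv (f := fun x : ℝ => χ (x / n)) h2]
      ring
    have h := wavePacket_bound hv hR hψ hψc
    simp only [hd, div_pow] at h
    rw [integral_div, Measure.integral_comp_div (fun x => χ x ^ 2),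
      Measure.integral_comp_div (fun x => deriv χ x ^ 2), abs_of_pos hn', smul_eq_mul,
      smul_eq_mul] at h
    calc (n : ℝ) ^ 2 * ((∫ x, χ x ^ 2) * ‖v‖ ^ 2) = n * (n * (∫ x, χ x ^ 2) * ‖v‖ ^ 2) := by ring
      _ ≤ n * (‖R‖ ^ 2 * (n * (∫ x, deriv χ x ^ 2) / n ^ 2 * ‖matOp pauli1 v‖ ^ 2)) := by gcongr
      _ = _ := by field_simp
  have hpos : 0 < (∫ x, χ x ^ 2) * ‖v‖ ^ 2 := by
    have h1 : 0 < ∫ x, χ x ^ 2 := by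
      refine Continuous.integral_pos_of_hasCompactSupport_nonneg_nonzero (x := (0 : ℝ))
        (hχ.continuous.pow 2) ?_ (fun x => sq_nonneg _) ?_
      · exact hχc.comp_left (g := fun t : ℝ => t ^ 2) (by simp)
      · have : χ (0 : ℝ) = 1 := χ.one_of_mem_closedBall (by simp [χ])
        simp [this]
    have h2 := norm_pos_iff.2 hv0
    positivity
  obtain ⟨n, hn⟩ := exists_nat_gt ((‖R‖ ^ 2 * ((∫ x, deriv χ x ^ 2) * ‖matOp pauli1 v‖ ^ 2)) /
    ((∫ x, χ x ^ 2) * ‖v‖ ^ 2))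
  rw [div_lt_iff₀ hpos] at hn
  have h1 := hb (n + 1) n.succ_pos
  push_cast at h1
  have h2 : (n : ℝ) ≤ (n + 1) ^ 2 := by nlinarith [Nat.cast_nonneg (α := ℝ) n]
  have h3 := mul_le_mul_of_nonneg_right h2 hpos.le
  linarith

theorem resolventSet_freeDirac (hm : 0 ≤ m) : resolventSet (freeDirac m) = (halfLines m)ᶜ := by
  ext z
  exact ⟨fun h hz => notMem_resolventSet_of_mem_halfLines hm hz h,
    fun hz => ⟨_, isResolventAt_freeRes hz⟩⟩

end WeylSequence

/-! ### The exceptional disks -/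

section Disks

variable {m : ℝ} {z : ℂ} {v : ℝ}

theorem diskRadius_eq (h1 : v < 1) (h0 : 0 ≤ v) :
    diskRadius v = √(v ^ 4 / (4 * (1 - v ^ 2))) := by
  have h : 0 < 1 - v ^ 2 := by nlinarith
  rw [diskRadius]
  congr 1
  field_simp
  ring

theorem diskRadius_sq (h1 : v < 1) (h0 : 0 ≤ v) :
    diskRadius v ^ 2 = v ^ 4 / (4 * (1 - v ^ 2)) := by
  have h : 0 < 1 - v ^ 2 := by nlinarith
  rw [diskRadius_eq h1 h0, Real.sq_sqrt (by positivity)]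

theorem diskCenter_sq (h1 : v < 1) (h0 : 0 ≤ v) :
    diskCenter v ^ 2 = 1 + v ^ 4 / (4 * (1 - v ^ 2)) := by
  have h : 0 < 1 - v ^ 2 := by nlinarith
  have e : (v ^ 4 - 2 * v ^ 2 + 2) / (4 * (1 - v ^ 2)) + 1 / 2 =
      1 + v ^ 4 / (4 * (1 - v ^ 2)) := by
    field_simp
    ring
  rw [diskCenter, e, Real.sq_sqrt (by positivity)]

theorem lt_of_notMem_disk {x r : ℝ} (hr : r ≠ 0) (h : z ∉ disk ((x : ℝ) : ℂ) r) (hr0 : 0 ≤ r) :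
    r ^ 2 < (z.re - x) ^ 2 + z.im ^ 2 := by
  rw [disk, if_neg hr, Metric.mem_closedBall, not_le, Complex.dist_eq] at h
  have h2 : r ^ 2 < ‖z - (x : ℂ)‖ ^ 2 := by gcongr
  rw [Complex.sq_norm, Complex.normSq_apply] at h2
  simp at h2
  nlinarith

/-- Write `A = |z + m|`, `B = |z - m|`. The claim is `v² (A² + B²) < 2 (2 - v²) A B`. By `x₀² = 1 +
r₀²`, lying outside both disks means `2 m x₀ |Re z| < |z|² + m²`, a condition on `A² - B² = 4 m Re
z` and `A² + B² = 2 (|z|² + m²)`, from which `A B` is recovered. -/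
theorem eta_mul_lt_one (hm : 0 ≤ m) (hz : z ∉ halfLines m) (h0 : 0 ≤ v) (h1 : v < 1)
    (hd : z ∉ disk ((m * diskCenter v : ℝ) : ℂ) (m * diskRadius v) ∪
      disk ((-(m * diskCenter v) : ℝ) : ℂ) (m * diskRadius v)) :
    eta ‖phi m z‖ * v < 1 := by
  rcases h0.eq_or_lt with rfl | hv
  · simp
  have hv1 : 0 < 1 - v ^ 2 := by nlinarith
  have hA := norm_pos_iff.2 (add_ne_zero_of_notMem hz)
  have hB := norm_pos_iff.2 (sub_ne_zero_of_notMem hz)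
  have hA2 : ‖z + m‖ ^ 2 = (z.re + m) ^ 2 + z.im ^ 2 := by
    rw [Complex.sq_norm, Complex.normSq_apply]
    simp
    ring
  have hB2 : ‖z - m‖ ^ 2 = (z.re - m) ^ 2 + z.im ^ 2 := by
    rw [Complex.sq_norm, Complex.normSq_apply]
    simp
    ring
  set A := ‖z + m‖
  set B := ‖z - m‖
  have hC := diskCenter_sq h1 h0
  have hD := diskRadius_sq h1 h0
  have hDn : 0 ≤ diskRadius v := Real.sqrt_nonneg _
  have hDp : 0 < diskRadius v := by
    rw [diskRadius_eq h1 h0, Real.sqrt_pos]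
    positivity
  set C := diskCenter v
  set D := diskRadius v
  have hCD : C ^ 2 = 1 + D ^ 2 := by rw [hC, hD]
  have hN : 0 < A ^ 2 + B ^ 2 := by positivity
  -- For `m = 0` the disks are empty and the left side is zero. For `m > 0` the radius is positive,
  -- so the convention for radius `0` does not interfere.
  have key : (4 * m * z.re * C) ^ 2 < (A ^ 2 + B ^ 2) ^ 2 := by
    rcases hm.eq_or_lt with rfl | hmp
    · simpa using pow_pos hN 2
    rw [Set.mem_union, not_or] at hd
    have hr := mul_pos hmp hDp
    have d1 := lt_of_notMem_disk hr.ne' hd.1 hr.le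
    have d2 := lt_of_notMem_disk hr.ne' hd.2 hr.le
    have hCD' : (m * C) ^ 2 = m ^ 2 + (m * D) ^ 2 := by rw [mul_pow, hCD]; ring
    refine sq_lt_sq' ?_ ?_ <;> rw [hA2, hB2] <;> nlinarith
  have hAB : (4 * m * z.re) ^ 2 = (A ^ 2 + B ^ 2) ^ 2 - 4 * (A * B) ^ 2 := by
    have : 4 * m * z.re = A ^ 2 - B ^ 2 := by rw [hA2, hB2]; ring
    rw [this]
    ring
  have hC' : C ^ 2 * (4 * (1 - v ^ 2)) = (2 - v ^ 2) ^ 2 := by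
    rw [hC]
    field_simp
    ring
  -- The coefficients match because `(2 - v²)² - 4 (1 - v²) = v⁴`.
  have key2 : (v ^ 2 * (A ^ 2 + B ^ 2)) ^ 2 < (2 * (2 - v ^ 2) * (A * B)) ^ 2 := by
    have h2 : (4 * m * z.re) ^ 2 * (2 - v ^ 2) ^ 2 < (A ^ 2 + B ^ 2) ^ 2 * (4 * (1 - v ^ 2)) := by
      rw [← hC', ← mul_assoc, ← mul_pow]
      gcongr
    rw [hAB] at h2
    linarith
  have hv2 : 0 < 2 - v ^ 2 := by nlinarith
  have key3 := lt_of_pow_lt_pow_left₀ 2 (by positivity) key2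
  have hη := eta_nonneg ‖phi m z‖
  have hphi : ‖phi m z‖ = A / B := norm_div _ _
  have h5 : (eta ‖phi m z‖ * v) ^ 2 < 1 := by
    rw [mul_pow, eta_sq (norm_nonneg _), hphi]
    have e : (1 / 2 + 1 / 4 * (A / B + (A / B)⁻¹)) * v ^ 2 =
        (2 * v ^ 2 * (A * B) + v ^ 2 * (A ^ 2 + B ^ 2)) / (4 * (A * B)) := by
      field_simp
      ring
    rw [e, div_lt_one (by positivity)]
    linarith
  exact (sq_lt_one_iff₀ (by positivity)).1 h5

end Disks

/-! ### Assembly: the Dirac operator as a factorized perturbation -/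

theorem exists_isFactorized {m : ℝ} (hm : 0 ≤ m) {V : ℝ → Matrix (Fin 2) (Fin 2) ℂ}
    (hV : ∀ i j : Fin 2, Integrable (fun x : ℝ => V x i j) volume) :
    ∃ X Y Q : ℂ → L2 →L[ℂ] L2, IsFactorized (freeDirac m) (factorA V) (factorB V) X Y Q ∧
      ∀ z ∉ halfLines m,
        ‖X z‖ ≤ eta ‖phi m z‖ * √(1 / (kFun m z).im) * √(potNorm V) ∧
        ‖Y z‖ ≤ eta ‖phi m z‖ * √(1 / (kFun m z).im) * √(potNorm V) ∧
        ‖Q z‖ ≤ eta ‖phi m z‖ * potNorm V := by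
  have hVi := integrable_matOp hV
  have hA : AEStronglyMeasurable fun x => sqrtAbs (matOp (V x)) :=
    continuous_sqrtAbs.comp_aestronglyMeasurable hVi.1
  have hB : AEStronglyMeasurable fun x => polarU (matOp (V x)) * sqrtAbs (matOp (V x)) := by
    obtain ⟨T, hT, hTe⟩ := hVi.1
    refine ⟨fun x => polarU (T x) * sqrtAbs (T x),
      stronglyMeasurable_polarU_mul_sqrtAbs.comp_measurable hT.measurable, ?_⟩
    filter_upwards [hTe] with x hx
    rw [hx]
  have hAn : ∀ x, ‖sqrtAbs (matOp (V x))‖ ≤ √‖matOp (V x)‖ := fun x => (norm_sqrtAbs _).le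
  have hBn : ∀ x, ‖polarU (matOp (V x)) * sqrtAbs (matOp (V x))‖ ≤ √‖matOp (V x)‖ := fun x =>
    norm_polarU_mul_sqrtAbs_le _
  have h : ∀ z, z ∉ halfLines m → ∃ X Y Q : L2 →L[ℂ] L2,
      (∀ f, ∃ h : resolvent (freeDirac m) z f ∈ (factorA V).domain, factorA V ⟨_, h⟩ = X f) ∧
      (∀ u : (factorB V).domain, Y u = resolvent (freeDirac m) z (factorB V u)) ∧
      (∀ u : (factorB V).domain, Q u = X (factorB V u)) ∧
        ‖X‖ ≤ eta ‖phi m z‖ * √(1 / (kFun m z).im) * √(potNorm V) ∧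
        ‖Y‖ ≤ eta ‖phi m z‖ * √(1 / (kFun m z).im) * √(potNorm V) ∧
        ‖Q‖ ≤ eta ‖phi m z‖ * potNorm V := by
    intro z hz
    rw [resolvent_eq (isResolventAt_freeRes hz)]
    obtain ⟨X, hX, hXn⟩ := exists_mulOp_freeRes hz hVi.norm (fun _ => norm_nonneg _) hA hAn
    obtain ⟨Y, hY, hYn⟩ := exists_freeRes_mulOp hz hVi.norm (fun _ => norm_nonneg _) hB hBn
    obtain ⟨Q, hQ, hQn⟩ := exists_mulOp_freeRes_mulOp hz hVi.norm (fun _ => norm_nonneg _) hB hBn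
      hAn hX
    exact ⟨X, Y, Q, hX, hY, hQ, hXn, hYn, hQn⟩
  -- On the half-lines the three families take arbitrary values; `IsFactorized` constrains them only
  -- on the resolvent set.
  choose! X Y Q h1 h2 h3 h4 using h
  refine ⟨X, Y, Q, ⟨dense_mulOp_domain hB, mulOp_closed, ?_, ?_, ?_⟩, h4⟩ <;>
    intro z hz <;> rw [resolventSet_freeDirac hm] at hz
  · exact h1 z hz
  · exact h2 z hz
  · exact h3 z hz

theorem norm_resolvent_freeDirac_le {m : ℝ} (hm : 0 ≤ m) {z : ℂ} (hz : z ∉ halfLines m) :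
    ‖resolvent (freeDirac m) z‖ ≤ 1 / Metric.infDist z (spectrum (freeDirac m)) := by
  have hR := isResolventAt_freeRes hz
  have := isStarNormal_freeRes hz
  rw [resolvent_eq hR]
  refine norm_le_inv_infDist_of_isStarNormal hR ?_
  rw [spectrum, resolventSet_freeDirac hm, compl_compl]
  exact ((isClosed_halfLines m).notMem_iff_infDist_pos (halfLines_nonempty m)).1 hz

end DiracLine

end

theorem mainTheorem9 (m : ℝ) (hm : 0 ≤ m) (V : ℝ → Matrix (Fin 2) (Fin 2) ℂ)
    (hV : ∀ i j : Fin 2, Integrable (fun x : ℝ => V x i j) volume)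
    (hV1 : DiracLine.potNorm V < 1) :
    DiracLine.resolventSet (DiracLine.freeDirac m) =
        ((fun x : ℝ => (x : ℂ)) '' (Iic (-m) ∪ Ici m))ᶜ ∧
      ∀ z ∈ DiracLine.resolventSet (DiracLine.freeDirac m),
        z ∉ DiracLine.disk ((m * DiracLine.diskCenter (DiracLine.potNorm V) : ℝ) : ℂ)
              (m * DiracLine.diskRadius (DiracLine.potNorm V)) ∪
            DiracLine.disk ((-(m * DiracLine.diskCenter (DiracLine.potNorm V)) : ℝ) : ℂ)
              (m * DiracLine.diskRadius (DiracLine.potNorm V)) →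
          z ∈ DiracLine.resolventSet (DiracLine.diracOperator m V) ∧
            DiracLine.eta ‖DiracLine.phi m z‖ * DiracLine.potNorm V < 1 ∧
            ‖DiracLine.resolvent (DiracLine.diracOperator m V) z‖ ≤
              1 / Metric.infDist z (DiracLine.spectrum (DiracLine.freeDirac m)) +
                DiracLine.eta ‖DiracLine.phi m z‖ ^ 2 / (DiracLine.kFun m z).im *
                  (DiracLine.potNorm V /
                    (1 - DiracLine.eta ‖DiracLine.phi m z‖ * DiracLine.potNorm V)) := by
  have hρ := DiracLine.resolventSet_freeDirac hm
  refine ⟨hρ, fun z hzρ hd => ?_⟩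
  have hz : z ∉ DiracLine.halfLines m := by rwa [hρ] at hzρ
  have hV0 := DiracLine.potNorm_nonneg V
  have hlt := DiracLine.eta_mul_lt_one hm hz hV0 hV1 hd
  obtain ⟨X, Y, Q, F, hF⟩ := DiracLine.exists_isFactorized hm hV
  obtain ⟨hX, hY, hQ⟩ := hF z hz
  obtain ⟨h1, h2⟩ := F.norm_resolvent_le hzρ hX hY hQ hlt
  refine ⟨h1, hlt, h2.trans (add_le_add (DiracLine.norm_resolvent_freeDirac_le hm hz) (le_of_eq ?_))⟩
  have hk := DiracLine.kFun_im_pos hz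
  have e1 := Real.sq_sqrt hV0
  have e2 : √(1 / (DiracLine.kFun m z).im) ^ 2 = 1 / (DiracLine.kFun m z).im :=
    Real.sq_sqrt (by positivity)
  calc _ = DiracLine.eta ‖DiracLine.phi m z‖ ^ 2 * √(1 / (DiracLine.kFun m z).im) ^ 2 *
        (√(DiracLine.potNorm V) ^ 2 /
          (1 - DiracLine.eta ‖DiracLine.phi m z‖ * DiracLine.potNorm V)) := by ring
    _ = _ := by rw [e1, e2]; ring
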